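/- Let $\mathbb{Q}_\mathbb{R}$ be the reduced biquaternions $\alpha_0+\alpha_1 i+\alpha_2 j+\alpha_3 k$ ($\alpha_t\in\mathbb{R}$, $i^2=k^2=-1$, $j^2=1$, $ij=ji=k$, $jk=kj=i$, $ki=ik=-j$), $|\alpha|^2=\sum_t\alpha_t^2$, and let $\|\cdot\|_F$, $\|\cdot\|_2$ denote the Frobenius and the spectral norm. For $M=M_0+M_1i+M_2j+M_3k$ over $\mathbb{Q}_\mathbb{R}$ with $M_t$ real, put $M_c^R=[M_0^T,M_1^T,M_2^T,M_3^T]^T$. Let $A\in\mathbb{Q}_\mathbb{R}^{m\times n}$, $B\in\mathbb{Q}_\mathbb{R}^{m\times d}$, $C\in\mathbb{Q}_\mathbb{R}^{p\times n}$, $D\in\mathbb{Q}_\mathbb{R}^{p\times d}$, with $m\ge n+d$ and $C_c^R$ of full row rank $4p$ (so $4p\le n$). A *real RBTLSE solution* for the data $(A,B,C,D)$ is an $X\in\mathbb{R}^{n\times d}$ for which some $\bar E,\bar F$ over $\mathbb{Q}_\mathbb{R}$ exist such that $(X,\bar E,\bar F)$ attains $$\min_{X,\bar E,\bar F}\|[\bar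 E,\bar F]\|_F\quad\text{subject to}\quad (A+\bar E)X=B+\bar F,\ \ CX=D,$$ the minimum being over real $X\in\mathbb{R}^{n\times d}$ and $\bar E\in\mathbb{Q}_\mathbb{R}^{m\times n}$, $\bar F\in\mathbb{Q}_\mathbb{R}^{m\times d}$. Put $\hat P=[A_c^R,B_c^R]$, $\hat S=[C_c^R,D_c^R]$. Let $\hat S^T=[\hat Q_1,\hat Q_2]\begin{bmatrix}\hat R\\0\end{bmatrix}$ be a QR factorization ($[\hat Q_1,\hat Q_2]$ orthogonal, $\hat Q_1$ with $4p$ columns, $\hat R\in\mathbb{R}^{4p\times 4p}$ upper triangular), and let $\hat P\hat Q_2=\hat U\hat\Sigma\hat V^T$ be a thin SVD with $\hat\Sigma=\mathrm{diag}(\hat\sigma_1,\dots,\hat\sigma_{n-4p+d})$, $$\hat\sigma_1\ge\dots\ge\hat\sigma_{n-4p}>\hat\sigma_{n-4p+1}\ge\dots\ge\hat\sigma_{n-4p+d}>0$$ (the strict inequality in the middle being void if $n=4p$). Partition $\hat U=[\hat U_1,\hat U_2]$, $\hat\Sigma=\mathrm{diag}(\hat\Sigma_1,\hat\Sigma_2)$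 and $\check V=\hat Q_2\hat V=[\check V_1,\check V_2]=\begin{bmatrix}\check V_{11}&\check V_{12}\\ \check V_{21}&\check V_{22}\end{bmatrix}$ with column blocks of sizes $n-4p$, $d$ and row blocks of $\check V$ of sizes $n$, $d$, and assume that $\check V_{22}$ is invertible. Let $\hat S=\hat U_s\hat S_s\hat V_s^T$ be a skinny SVD (with $\hat S_s$ of size $4p\times 4p$), $\hat S^\dagger$ the Moore–Penrose inverse of $\hat S$, and define $$Q_r=\begin{bmatrix}-(\hat P\hat S^\dagger)^T\\ I_{4m}\end{bmatrix},\quad S_r=\begin{bmatrix}\hat S_s&0\\0&\hat\Sigma_1\end{bmatrix},\quad [\hat V_s,\check V_1]=\begin{bmatrix}W_{1r}\\W_{2r}\end{bmatrix}\ (W_{1r}\in\mathbb{R}^{n\times n}),\quad \Pi_{(d,n)}=\sum_{i=1}^d\sum_{j=1}^nE_{ij}\otimes E_{ij}^T,$$ where $E_{ij}\in\mathbb{R}^{d\times n}$ has a single nonzero entry, a $1$ at position $(i,j)$, and $$H_r=(\check V_{22}^{-T}\otimes W_{1r}^{-T})\,\Pi_{(d,n)},$$ $$G_r=\left(S_r^2\otimes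 I_d-\begin{bmatrix}0_{4p}&0\\0&I_{n-4p}\end{bmatrix}\otimes(\hat\Sigma_2^T\hat\Sigma_2)\right)^{-1}\left[I_n\otimes\hat\Sigma_2^T,\ S_r\otimes I_d\right],$$ $$Z_r=\mathrm{diag}\left(\begin{bmatrix}0_{4p}&0\\0&I_{n-4p}\end{bmatrix}\otimes(\hat U_2^TQ_r^T),\ \begin{bmatrix}I_{4p}&0\\-\hat U_1^T(\hat P\hat S^\dagger)\hat U_s&I_{n-4p}\end{bmatrix}\otimes I_d\right).$$ Let $J=\begin{bmatrix}C\\A\end{bmatrix}$, $K=\begin{bmatrix}D\\B\end{bmatrix}$, $J_r=\begin{bmatrix}C_c^R\\A_c^R\end{bmatrix}$, $K_r=\begin{bmatrix}D_c^R\\B_c^R\end{bmatrix}$, and for perturbations $\Delta A,\Delta B,\Delta C,\Delta D$ of the data let $\Delta J=\begin{bmatrix}\Delta C\\ \Delta A\end{bmatrix}$, $\Delta K=\begin{bmatrix}\Delta D\\ \Delta B\end{bmatrix}$. Let $X_{RT}$ be the real RBTLSE solution for $(A,B,C,D)$ and assume $X_{RT}\ne0$. Then for all perturbations with $\|[\Delta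 J,\Delta K]\|_F\le\delta\|[J,K]\|_F$, where $\delta>0$ is some constant depending on the data, the perturbed data $(A+\Delta A,B+\Delta B,C+\Delta C,D+\Delta D)$ have exactly one real RBTLSE solution $\widehat X_{RT}$; and with $\Delta X_{RT}=X_{RT}-\widehat X_{RT}$, the supremum below is finite for all small $\epsilon>0$, the limit exists, and the relative normwise condition number is $$\lim_{\epsilon\to0^+}\sup\left\{\frac{\|\Delta X_{RT}\|_F}{\epsilon\|X_{RT}\|_F}\ :\ \|[\Delta J,\Delta K]\|_F\le\epsilon\|[J,K]\|_F\right\}=\|H_rG_rZ_r\|_2\,\frac{\|[J_r,K_r]\|_F}{\|X_{RT}\|_F}.$$ -/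

import Mathlib

open Matrix Filter Topology
open scoped Kronecker

/-- Reduced biquaternions `re + imI i + imJ j + imK k`, with
`i² = k² = -1`, `j² = 1`, `ij = ji = k`, `jk = kj = i`, `ki = ik = -j`. -/
@[ext]
structure RBQ where
  re : ℝ
  imI : ℝ
  imJ : ℝ
  imK : ℝ

namespace RBQ

instance : Zero RBQ := ⟨⟨0, 0, 0, 0⟩⟩
instance : One RBQ := ⟨⟨1, 0, 0, 0⟩⟩
instance : Add RBQ :=
  ⟨fun a b => ⟨a.re + b.re, a.imI + b.imI, a.imJ + b.imJ, a.imK + b.imK⟩⟩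
instance : Neg RBQ := ⟨fun a => ⟨-a.re, -a.imI, -a.imJ, -a.imK⟩⟩
instance : Mul RBQ :=
  ⟨fun a b =>
    ⟨a.re * b.re - a.imI * b.imI + a.imJ * b.imJ - a.imK * b.imK,
     a.re * b.imI + a.imI * b.re + a.imJ * b.imK + a.imK * b.imJ,
     a.re * b.imJ - a.imI * b.imK + a.imJ * b.re - a.imK * b.imI,
     a.re * b.imK + a.imI * b.imJ + a.imJ * b.imI + a.imK * b.re⟩⟩

@[simp] theorem zero_re : (0 : RBQ).re = 0 := rfl
@[simp] theorem zero_imI : (0 : RBQ).imI = 0 := rfl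
@[simp] theorem zero_imJ : (0 : RBQ).imJ = 0 := rfl
@[simp] theorem zero_imK : (0 : RBQ).imK = 0 := rfl
@[simp] theorem one_re : (1 : RBQ).re = 1 := rfl
@[simp] theorem one_imI : (1 : RBQ).imI = 0 := rfl
@[simp] theorem one_imJ : (1 : RBQ).imJ = 0 := rfl
@[simp] theorem one_imK : (1 : RBQ).imK = 0 := rfl
@[simp] theorem add_re (a b : RBQ) : (a + b).re = a.re + b.re := rfl
@[simp] theorem add_imI (a b : RBQ) : (a + b).imI = a.imI + b.imI := rfl
@[simp] theorem add_imJ (a b : RBQ) : (a + b).imJ = a.imJ + b.imJ := rfl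
@[simp] theorem add_imK (a b : RBQ) : (a + b).imK = a.imK + b.imK := rfl
@[simp] theorem neg_re (a : RBQ) : (-a).re = -a.re := rfl
@[simp] theorem neg_imI (a : RBQ) : (-a).imI = -a.imI := rfl
@[simp] theorem neg_imJ (a : RBQ) : (-a).imJ = -a.imJ := rfl
@[simp] theorem neg_imK (a : RBQ) : (-a).imK = -a.imK := rfl
@[simp] theorem mul_re (a b : RBQ) :
    (a * b).re = a.re * b.re - a.imI * b.imI + a.imJ * b.imJ - a.imK * b.imK := rfl
@[simp] theorem mul_imI (a b : RBQ) :
    (a * b).imI = a.re * b.imI + a.imI * b.re + a.imJ * b.imK + a.imK * b.imJ := rfl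
@[simp] theorem mul_imJ (a b : RBQ) :
    (a * b).imJ = a.re * b.imJ - a.imI * b.imK + a.imJ * b.re - a.imK * b.imI := rfl
@[simp] theorem mul_imK (a b : RBQ) :
    (a * b).imK = a.re * b.imK + a.imI * b.imJ + a.imJ * b.imI + a.imK * b.re := rfl

noncomputable instance : CommRing RBQ where
  add_assoc a b c := by ext <;> simp <;> ring
  zero_add a := by ext <;> simp
  add_zero a := by ext <;> simp
  add_comm a b := by ext <;> simp <;> ring
  neg_add_cancel a := by ext <;> simp
  mul_assoc a b c := by ext <;> simp <;> ring
  one_mul a := by ext <;> simp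
  mul_one a := by ext <;> simp
  left_distrib a b c := by ext <;> simp <;> ring
  right_distrib a b c := by ext <;> simp <;> ring
  zero_mul a := by ext <;> simp
  mul_zero a := by ext <;> simp
  mul_comm a b := by ext <;> simp <;> ring
  nsmul := nsmulRec
  zsmul := zsmulRec

noncomputable instance : Norm RBQ :=
  ⟨fun a => Real.sqrt (a.re ^ 2 + a.imI ^ 2 + a.imJ ^ 2 + a.imK ^ 2)⟩

/-- A real number as a reduced biquaternion. -/
def ofReal (x : ℝ) : RBQ := ⟨x, 0, 0, 0⟩

/-- The four real components, in the order `1, i, j, k`. -/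
def coord (t : Fin 4) (a : RBQ) : ℝ := ![a.re, a.imI, a.imJ, a.imK] t

end RBQ

namespace RBTLSE

/-- Frobenius norm of a reduced biquaternion matrix. -/
noncomputable def rbFrob {ι κ : Type*} [Fintype ι] [Fintype κ] (P : Matrix ι κ RBQ) : ℝ :=
  Real.sqrt (∑ i, ∑ j, ‖P i j‖ ^ 2)

open scoped Matrix.Norms.Frobenius in
/-- Frobenius norm of a real matrix. -/
noncomputable def frob {ι κ : Type*} [Fintype ι] [Fintype κ] (M : Matrix ι κ ℝ) : ℝ := ‖M‖

open scoped Matrix.Norms.L2Operator in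
/-- Spectral norm of a real matrix. -/
noncomputable def specNorm {ι κ : Type*} [Fintype ι] [Fintype κ] [DecidableEq κ]
    (M : Matrix ι κ ℝ) : ℝ := ‖M‖

/-- For `P = P₀ + P₁ i + P₂ j + P₃ k`, the real `4m × n` matrix `[P₀ᵀ, P₁ᵀ, P₂ᵀ, P₃ᵀ]ᵀ`
(row `t * m + i` is row `i` of `P_t`). -/
def realCol {m n : ℕ} (P : Matrix (Fin m) (Fin n) RBQ) : Matrix (Fin (4 * m)) (Fin n) ℝ :=
  Matrix.of fun r c => RBQ.coord (finProdFinEquiv.symm r).1 (P (finProdFinEquiv.symm r).2 c)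

/-- `(A + E) X = B + F`, `C X = D`, with `X` real. -/
def Feasible {m n d p : ℕ}
    (A : Matrix (Fin m) (Fin n) RBQ) (B : Matrix (Fin m) (Fin d) RBQ)
    (C : Matrix (Fin p) (Fin n) RBQ) (D : Matrix (Fin p) (Fin d) RBQ)
    (X : Matrix (Fin n) (Fin d) ℝ)
    (E : Matrix (Fin m) (Fin n) RBQ) (F : Matrix (Fin m) (Fin d) RBQ) : Prop :=
  (A + E) * X.map RBQ.ofReal = B + F ∧ C * X.map RBQ.ofReal = D

/-- `X` is a real solution of the problem of minimizing `‖[E, F]‖_F` over real `X` and reduced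
biquaternion `E`, `F` subject to `(A + E) X = B + F`, `C X = D`. -/
def IsRealSolution {m n d p : ℕ}
    (A : Matrix (Fin m) (Fin n) RBQ) (B : Matrix (Fin m) (Fin d) RBQ)
    (C : Matrix (Fin p) (Fin n) RBQ) (D : Matrix (Fin p) (Fin d) RBQ)
    (X : Matrix (Fin n) (Fin d) ℝ) : Prop :=
  ∃ (E : Matrix (Fin m) (Fin n) RBQ) (F : Matrix (Fin m) (Fin d) RBQ),
    Feasible A B C D X E F ∧
    ∀ (X' : Matrix (Fin n) (Fin d) ℝ)
      (E' : Matrix (Fin m) (Fin n) RBQ) (F' : Matrix (Fin m) (Fin d) RBQ),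
      Feasible A B C D X' E' F' → rbFrob (fromCols E F) ≤ rbFrob (fromCols E' F')

/-- `‖[J, K]‖_F` with `J = [C; A]`, `K = [D; B]`. -/
noncomputable def dataNorm {m n d p : ℕ}
    (A : Matrix (Fin m) (Fin n) RBQ) (B : Matrix (Fin m) (Fin d) RBQ)
    (C : Matrix (Fin p) (Fin n) RBQ) (D : Matrix (Fin p) (Fin d) RBQ) : ℝ :=
  rbFrob (fromCols (fromRows C A) (fromRows D B))

/-- The problem is well posed near the data: after every sufficiently small perturbation of
the data there is exactly one real solution. -/
def LocallyUniquelySolvable {m n d p : ℕ}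
    (A : Matrix (Fin m) (Fin n) RBQ) (B : Matrix (Fin m) (Fin d) RBQ)
    (C : Matrix (Fin p) (Fin n) RBQ) (D : Matrix (Fin p) (Fin d) RBQ) : Prop :=
  ∃ δ : ℝ, 0 < δ ∧
    ∀ (ΔA : Matrix (Fin m) (Fin n) RBQ) (ΔB : Matrix (Fin m) (Fin d) RBQ)
      (ΔC : Matrix (Fin p) (Fin n) RBQ) (ΔD : Matrix (Fin p) (Fin d) RBQ),
      dataNorm ΔA ΔB ΔC ΔD ≤ δ * dataNorm A B C D →
      ∃! X : Matrix (Fin n) (Fin d) ℝ, IsRealSolution (A + ΔA) (B + ΔB) (C + ΔC) (D + ΔD) X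

/-- The relative errors, divided by `ε`, of the real solutions of the perturbed problems with
relative data perturbation at most `ε`. -/
def relErrors {m n d p : ℕ}
    (A : Matrix (Fin m) (Fin n) RBQ) (B : Matrix (Fin m) (Fin d) RBQ)
    (C : Matrix (Fin p) (Fin n) RBQ) (D : Matrix (Fin p) (Fin d) RBQ)
    (X : Matrix (Fin n) (Fin d) ℝ) (ε : ℝ) : Set ℝ :=
  {r | ∃ (ΔA : Matrix (Fin m) (Fin n) RBQ) (ΔB : Matrix (Fin m) (Fin d) RBQ)
      (ΔC : Matrix (Fin p) (Fin n) RBQ) (ΔD : Matrix (Fin p) (Fin d) RBQ)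
      (X' : Matrix (Fin n) (Fin d) ℝ),
      dataNorm ΔA ΔB ΔC ΔD ≤ ε * dataNorm A B C D ∧
      IsRealSolution (A + ΔA) (B + ΔB) (C + ΔC) (D + ΔD) X' ∧
      r = frob (X - X') / (ε * frob X)}

/-- `k` is the relative normwise condition number of the solution `X`: the supremum of
`relErrors` is finite for small `ε > 0` and tends to `k` as `ε → 0⁺`. -/
def HasRelCondNumber {m n d p : ℕ}
    (A : Matrix (Fin m) (Fin n) RBQ) (B : Matrix (Fin m) (Fin d) RBQ)
    (C : Matrix (Fin p) (Fin n) RBQ) (D : Matrix (Fin p) (Fin d) RBQ)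
    (X : Matrix (Fin n) (Fin d) ℝ) (k : ℝ) : Prop :=
  ∃ s : ℝ → ℝ, (∀ᶠ ε in 𝓝[>] (0 : ℝ), IsLUB (relErrors A B C D X ε) (s ε)) ∧
    Tendsto s (𝓝[>] (0 : ℝ)) (𝓝 k)

/-- `M = U diag(σ) Vᵀ` is a thin (skinny) singular value decomposition. -/
structure IsThinSVD {ι κ : Type*} [Fintype ι] [Fintype κ] {r : ℕ} (M : Matrix ι κ ℝ)
    (U : Matrix ι (Fin r) ℝ) (σ : Fin r → ℝ) (V : Matrix κ (Fin r) ℝ) : Prop where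
  left_orthonormal : Uᵀ * U = 1
  right_orthonormal : Vᵀ * V = 1
  antitone : Antitone σ
  nonneg : ∀ i, 0 ≤ σ i
  eq : M = U * diagonal σ * Vᵀ

/-- `Y` is the Moore–Penrose inverse of `M`. -/
structure IsMoorePenrose {ι κ : Type*} [Fintype ι] [Fintype κ]
    (M : Matrix ι κ ℝ) (Y : Matrix κ ι ℝ) : Prop where
  mul_mul : M * Y * M = M
  inv_mul_inv : Y * M * Y = Y
  left_symm : (M * Y)ᵀ = M * Y
  right_symm : (Y * M)ᵀ = Y * M

/-- `Π_(d,n) = ∑ᵢ ∑ⱼ Eᵢⱼ ⊗ Eᵢⱼᵀ`. -/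
def permMatrix (d n : ℕ) : Matrix (Fin d × Fin n) (Fin n × Fin d) ℝ :=
  ∑ i : Fin d, ∑ j : Fin n, Matrix.single i j (1 : ℝ) ⊗ₖ (Matrix.single i j (1 : ℝ))ᵀ

/-- The first `a` columns. -/
def leftCols {ι : Type*} {a b : ℕ} (M : Matrix ι (Fin (a + b)) ℝ) : Matrix ι (Fin a) ℝ :=
  M.submatrix id (Fin.castAdd b)

/-- The last `b` columns. -/
def rightCols {ι : Type*} {a b : ℕ} (M : Matrix ι (Fin (a + b)) ℝ) : Matrix ι (Fin b) ℝ :=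
  M.submatrix id (Fin.natAdd a)

/-- Blocks of sizes `a` and `b` put next to each other to give size `n = a + b`. -/
def blockEquiv {a b n : ℕ} (h : n = a + b) : Fin a ⊕ Fin b ≃ Fin n :=
  finSumFinEquiv.trans (finCongr h.symm)

/-- The `n × n` matrix with the given blocks, where `n = a + b`. -/
def block {a b n : ℕ} (h : n = a + b)
    (M₁₁ : Matrix (Fin a) (Fin a) ℝ) (M₁₂ : Matrix (Fin a) (Fin b) ℝ)
    (M₂₁ : Matrix (Fin b) (Fin a) ℝ) (M₂₂ : Matrix (Fin b) (Fin b) ℝ) :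
    Matrix (Fin n) (Fin n) ℝ :=
  reindex (blockEquiv h) (blockEquiv h) (fromBlocks M₁₁ M₁₂ M₂₁ M₂₂)

/-- `[-(P S†)ᵀ; I]`, with `Y` in the role of `S†`. -/
def Qr {μ ν κ : Type*} [Fintype κ] [DecidableEq μ]
    (P : Matrix μ κ ℝ) (Y : Matrix κ ν ℝ) : Matrix (ν ⊕ μ) μ ℝ :=
  fromRows (-(P * Y)ᵀ) 1

/-- The upper `n × n` part of `W = [V_s, V̌₁]`, where `n = a + b`. -/
def W1 {a b n d : ℕ} (h : n = a + b) (Vs : Matrix (Fin n ⊕ Fin d) (Fin a) ℝ)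
    (V1 : Matrix (Fin n ⊕ Fin d) (Fin b) ℝ) : Matrix (Fin n) (Fin n) ℝ :=
  (fromCols Vs V1).submatrix Sum.inl (blockEquiv h).symm

/-- `H = (V₂₂⁻ᵀ ⊗ W₁⁻ᵀ) Π_(d,n)`. -/
noncomputable def Hr {n d : ℕ} (V22 : Matrix (Fin d) (Fin d) ℝ) (W : Matrix (Fin n) (Fin n) ℝ) :
    Matrix (Fin d × Fin n) (Fin n × Fin d) ℝ :=
  ((V22⁻¹)ᵀ ⊗ₖ (W⁻¹)ᵀ) * permMatrix d n

/-- `G = (S² ⊗ I_d - diag(0_a, I_b) ⊗ (Σ₂ᵀ Σ₂))⁻¹ [I_n ⊗ Σ₂ᵀ, S ⊗ I_d]`. -/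
noncomputable def Gr {a b n d : ℕ} (h : n = a + b) (S : Matrix (Fin n) (Fin n) ℝ)
    (Sig2 : Matrix (Fin d) (Fin d) ℝ) :
    Matrix (Fin n × Fin d) ((Fin n × Fin d) ⊕ (Fin n × Fin d)) ℝ :=
  ((S ^ 2) ⊗ₖ (1 : Matrix (Fin d) (Fin d) ℝ) - (block h 0 0 0 1) ⊗ₖ (Sig2ᵀ * Sig2))⁻¹ *
    fromCols ((1 : Matrix (Fin n) (Fin n) ℝ) ⊗ₖ Sig2ᵀ) (S ⊗ₖ (1 : Matrix (Fin d) (Fin d) ℝ))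

/-- `Z = diag(diag(0_a, I_b) ⊗ (U₂ᵀ Qᵀ), [I_a, 0; -U₁ᵀ (P S†) U_s, I_b] ⊗ I_d)`,
with `Y` in the role of `S†`. -/
def Zr {a b n d : ℕ} {μ ν κ : Type*} [Fintype μ] [DecidableEq μ] [Fintype ν] [Fintype κ]
    (h : n = a + b) (P : Matrix μ κ ℝ) (Y : Matrix κ ν ℝ) (Us : Matrix ν (Fin a) ℝ)
    (U1 : Matrix μ (Fin b) ℝ) (U2 : Matrix μ (Fin d) ℝ) :
    Matrix ((Fin n × Fin d) ⊕ (Fin n × Fin d)) ((Fin n × (ν ⊕ μ)) ⊕ (Fin n × Fin d)) ℝ :=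
  fromBlocks
    ((block h 0 0 0 1) ⊗ₖ (U2ᵀ * (Qr P Y)ᵀ)) 0
    0 ((block h 1 0 (-(U1ᵀ * (P * Y) * Us)) 1) ⊗ₖ (1 : Matrix (Fin d) (Fin d) ℝ))

end RBTLSE

namespace RBTLSE

/-! ### Passage from reduced biquaternions to stacked real components. -/

section Reduction

variable {m n d p : ℕ}

/-! A real unknown `X` acts on each of the four components separately, and stacking the components
preserves Frobenius norms. The problem is therefore the real one with data `[S; P]`
(`isRealSolution_iff`). For a fixed `X` put `N = [X; -I]`. The cheapest correction of `P` is `-P *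
proj N`, so `X` minimizes the trace of `Pᵀ P proj N` among those `N` with `S N = 0`.

A Ky Fan argument certifies a unique global minimizer. It suffices to have a `K` which together with
`N` spans the kernel of `S`, is orthogonal to `N` both in the usual sense and for the form `Pᵀ P`,
and a number `lam` such that `Pᵀ P - lam` is positive on the span of `K` and negative on that of `N`
(`trace_proj_le`, `isTLSESol_iff_eq`). At the given data `N` spans the columns of `V₂`, `K` is `V₁`,
and the gap between the singular values supplies `lam`.

The equations for `N` and `K` form a system with as many unknowns as equations. Its linearization in
the unknowns is injective because the Sylvester map `b ↦ Σ₁² b - b Σ₂²` is. The implicit function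
theorem thus continues the pair `(X, K)` to nearby data. The strict inequalities of the certificate
persist, so the continued `X` is the only global solution there, and it is differentiable at the
data (`exists_solution_map`).

The condition number is then the rescaled operator norm of the derivative `L`
(`exists_tendsto_sup_errors`). The value `L Δ` depends only on `Δ W` and `Tᵀ Δ V₂`, with `W = [V_s,
V₁]` and `T = diag(U_s, U₁)`. These coordinates are a coisometric image of `Δ`, and on them `L` acts
as the matrix `H G Z` (`AdaptedBasis.condition_matrix_mulVec`). Hence the norm of `L` is the
spectral norm of `H G Z` (`opNorm_eq_specNorm`). -/

theorem realCol_add (P Q : Matrix (Fin m) (Fin n) RBQ) :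
    realCol (P + Q) = realCol P + realCol Q := by
  ext r c
  simp only [realCol, of_apply, Matrix.add_apply]
  generalize (finProdFinEquiv.symm r).1 = t
  generalize P _ c = a, Q _ c = b
  fin_cases t <;> rfl

theorem coord_sum {ι : Type*} (s : Finset ι) (f : ι → RBQ) (t : Fin 4) :
    RBQ.coord t (∑ i ∈ s, f i) = ∑ i ∈ s, RBQ.coord t (f i) := by
  classical
  induction s using Finset.induction_on with
  | empty => fin_cases t <;> rfl
  | insert a s ha ih =>
    rw [Finset.sum_insert ha, Finset.sum_insert ha, ← ih]
    fin_cases t <;> rfl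

theorem coord_mul_ofReal (a : RBQ) (x : ℝ) (t : Fin 4) :
    RBQ.coord t (a * RBQ.ofReal x) = RBQ.coord t a * x := by
  fin_cases t <;> simp [RBQ.coord, RBQ.ofReal]

/-- Multiplication by a real number does not mix the components, so the first block column suffices
and the full real representation of the ring is never needed. -/
theorem realCol_mul_ofReal (P : Matrix (Fin m) (Fin n) RBQ) (X : Matrix (Fin n) (Fin d) ℝ) :
    realCol (P * X.map RBQ.ofReal) = realCol P * X := by
  ext r c
  simp [realCol, mul_apply, coord_sum, coord_mul_ofReal]

/-- The reduced biquaternion matrix with the given stack of real components. -/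
def ofRealCol (M : Matrix (Fin (4 * m)) (Fin n) ℝ) : Matrix (Fin m) (Fin n) RBQ :=
  Matrix.of fun i c => ⟨M (finProdFinEquiv (0, i)) c, M (finProdFinEquiv (1, i)) c,
    M (finProdFinEquiv (2, i)) c, M (finProdFinEquiv (3, i)) c⟩

theorem realCol_ofRealCol (M : Matrix (Fin (4 * m)) (Fin n) ℝ) : realCol (ofRealCol M) = M := by
  ext r c
  obtain ⟨⟨t, i⟩, rfl⟩ := finProdFinEquiv.surjective r
  simp only [realCol, of_apply, Equiv.symm_apply_apply, ofRealCol]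
  fin_cases t <;> rfl

theorem realCol_injective :
    Function.Injective (realCol : Matrix (Fin m) (Fin n) RBQ → Matrix (Fin (4 * m)) (Fin n) ℝ) := by
  intro P Q h
  have key : ∀ t i c, RBQ.coord t (P i c) = RBQ.coord t (Q i c) := by
    intro t i c
    have := congrFun (congrFun h (finProdFinEquiv (t, i))) c
    simpa only [realCol, of_apply, Equiv.symm_apply_apply] using this
  ext i c
  exacts [key 0 i c, key 1 i c, key 2 i c, key 3 i c]

theorem frob_eq_sqrt {ι κ : Type*} [Fintype ι] [Fintype κ] (M : Matrix ι κ ℝ) :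
    frob M = Real.sqrt (∑ i, ∑ j, M i j ^ 2) := by
  rw [frob, frobenius_norm_def, Real.sqrt_eq_rpow]
  simp

theorem RBQ_norm_sq (a : RBQ) : ‖a‖ ^ 2 = ∑ t, RBQ.coord t a ^ 2 := by
  change Real.sqrt _ ^ 2 = _
  rw [Real.sq_sqrt (by positivity), Fin.sum_univ_four]
  rfl

theorem sum_norm_sq_eq (P : Matrix (Fin m) (Fin n) RBQ) :
    ∑ i, ∑ j, ‖P i j‖ ^ 2 = ∑ r, ∑ j, realCol P r j ^ 2 := by
  have h : ∑ r, ∑ j, realCol P r j ^ 2 =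
      ∑ t : Fin 4, ∑ i, ∑ j, realCol P (finProdFinEquiv (t, i)) j ^ 2 := by
    rw [← (finProdFinEquiv (m := 4) (n := m)).sum_comp, Fintype.sum_prod_type]
  rw [h, eq_comm, Finset.sum_comm]
  refine Finset.sum_congr rfl fun i _ => ?_
  simp only [RBQ_norm_sq, realCol, of_apply, Equiv.symm_apply_apply]
  exact Finset.sum_comm

theorem rbFrob_fromCols (E : Matrix (Fin m) (Fin n) RBQ) (F : Matrix (Fin m) (Fin d) RBQ) :
    rbFrob (fromCols E F) = frob (fromCols (realCol E) (realCol F)) := by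
  rw [rbFrob, frob_eq_sqrt]
  congr 1
  simp only [Fintype.sum_sum_type, fromCols_apply_inl, fromCols_apply_inr, Finset.sum_add_distrib]
  rw [sum_norm_sq_eq, sum_norm_sq_eq]

/-- The real data matrix `[S; P]` with `S = [C, D]` and `P = [A, B]`, in stacked components. -/
def realData (A : Matrix (Fin m) (Fin n) RBQ) (B : Matrix (Fin m) (Fin d) RBQ)
    (C : Matrix (Fin p) (Fin n) RBQ) (D : Matrix (Fin p) (Fin d) RBQ) :
    Matrix (Fin (4 * p) ⊕ Fin (4 * m)) (Fin n ⊕ Fin d) ℝ :=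
  fromRows (fromCols (realCol C) (realCol D)) (fromCols (realCol A) (realCol B))

theorem dataNorm_eq (A : Matrix (Fin m) (Fin n) RBQ) (B : Matrix (Fin m) (Fin d) RBQ)
    (C : Matrix (Fin p) (Fin n) RBQ) (D : Matrix (Fin p) (Fin d) RBQ) :
    dataNorm A B C D = frob (realData A B C D) := by
  rw [dataNorm, rbFrob, frob_eq_sqrt, realData]
  congr 1
  simp only [Fintype.sum_sum_type, fromCols_apply_inl, fromCols_apply_inr, fromRows_apply_inl,
    fromRows_apply_inr, Finset.sum_add_distrib, sum_norm_sq_eq]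

theorem realData_add (A A' : Matrix (Fin m) (Fin n) RBQ) (B B' : Matrix (Fin m) (Fin d) RBQ)
    (C C' : Matrix (Fin p) (Fin n) RBQ) (D D' : Matrix (Fin p) (Fin d) RBQ) :
    realData (A + A') (B + B') (C + C') (D + D') = realData A B C D + realData A' B' C' D' := by
  simp only [realData, realCol_add]
  ext (i | i) (j | j) <;> rfl

/-- Lets the supremum over biquaternion perturbations run over a full space of real matrices. -/
theorem realData_surjective (M : Matrix (Fin (4 * p) ⊕ Fin (4 * m)) (Fin n ⊕ Fin d) ℝ) :
    ∃ (A : Matrix (Fin m) (Fin n) RBQ) (B : Matrix (Fin m) (Fin d) RBQ)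
      (C : Matrix (Fin p) (Fin n) RBQ) (D : Matrix (Fin p) (Fin d) RBQ),
      realData A B C D = M := by
  refine ⟨ofRealCol M.toRows₂.toCols₁, ofRealCol M.toRows₂.toCols₂,
    ofRealCol M.toRows₁.toCols₁, ofRealCol M.toRows₁.toCols₂, ?_⟩
  simp only [realData, realCol_ofRealCol, fromCols_toCols, fromRows_toRows]

end Reduction

/-! ### The real total least squares problem with equality constraints. -/

/-- The matrix `[X; -I]`, whose columns are annihilated by `[A, B]` when `A X = B`. -/
def aug {ι τ : Type*} [DecidableEq τ] (X : Matrix ι τ ℝ) : Matrix (ι ⊕ τ) τ ℝ :=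
  fromRows X (-1)

/-- `X` solves the real total least squares problem with equality constraints for the data
`D = [S; P]`: minimize `‖E‖_F` subject to `(P + E) [X; -I] = 0` and `S [X; -I] = 0`. -/
def IsTLSESol {ν μ ι τ : Type*} [Fintype μ] [Fintype ι] [Fintype τ] [DecidableEq τ]
    (D : Matrix (ν ⊕ μ) (ι ⊕ τ) ℝ) (X : Matrix ι τ ℝ) : Prop :=
  D.toRows₁ * aug X = 0 ∧ ∃ E : Matrix μ (ι ⊕ τ) ℝ, (D.toRows₂ + E) * aug X = 0 ∧
    ∀ (X' : Matrix ι τ ℝ) (E' : Matrix μ (ι ⊕ τ) ℝ), D.toRows₁ * aug X' = 0 →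
      (D.toRows₂ + E') * aug X' = 0 → frob E ≤ frob E'

theorem fromCols_mul_aug_eq_zero {μ ι τ : Type*} [Fintype ι] [Fintype τ] [DecidableEq τ]
    (A : Matrix μ ι ℝ) (B : Matrix μ τ ℝ) (X : Matrix ι τ ℝ) :
    fromCols A B * aug X = 0 ↔ A * X = B := by
  rw [aug, fromCols_mul_fromRows, Matrix.mul_neg, Matrix.mul_one, ← sub_eq_add_neg, sub_eq_zero]

theorem feasible_iff {m n d p : ℕ}
    (A : Matrix (Fin m) (Fin n) RBQ) (B : Matrix (Fin m) (Fin d) RBQ)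
    (C : Matrix (Fin p) (Fin n) RBQ) (D : Matrix (Fin p) (Fin d) RBQ)
    (X : Matrix (Fin n) (Fin d) ℝ)
    (E : Matrix (Fin m) (Fin n) RBQ) (F : Matrix (Fin m) (Fin d) RBQ) :
    Feasible A B C D X E F ↔ (realData A B C D).toRows₁ * aug X = 0 ∧
      ((realData A B C D).toRows₂ + fromCols (realCol E) (realCol F)) * aug X = 0 := by
  have h : (realData A B C D).toRows₂ + fromCols (realCol E) (realCol F) =
      fromCols (realCol (A + E)) (realCol (B + F)) := by
    simp only [realData, realCol_add]
    ext i (j | j) <;> rfl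
  rw [h, fromCols_mul_aug_eq_zero, realData, toRows₁_fromRows, fromCols_mul_aug_eq_zero,
    ← realCol_mul_ofReal, ← realCol_mul_ofReal, realCol_injective.eq_iff, realCol_injective.eq_iff,
    Feasible, and_comm]

/-- Feasibility transfers by injectivity of `realCol`. Stacking the pair of corrections is onto and
preserves the norm, so the competitors are the same on both sides. -/
theorem isRealSolution_iff {m n d p : ℕ}
    (A : Matrix (Fin m) (Fin n) RBQ) (B : Matrix (Fin m) (Fin d) RBQ)
    (C : Matrix (Fin p) (Fin n) RBQ) (D : Matrix (Fin p) (Fin d) RBQ)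
    (X : Matrix (Fin n) (Fin d) ℝ) :
    IsRealSolution A B C D X ↔ IsTLSESol (realData A B C D) X := by
  have surj : ∀ E' : Matrix (Fin (4 * m)) (Fin n ⊕ Fin d) ℝ, ∃ E F, E' =
      fromCols (realCol (n := n) E) (realCol (n := d) F) := fun E' =>
    ⟨ofRealCol E'.toCols₁, ofRealCol E'.toCols₂, by
      simp only [realCol_ofRealCol, fromCols_toCols]⟩
  simp only [IsRealSolution, IsTLSESol, feasible_iff, rbFrob_fromCols]
  constructor
  · rintro ⟨E, F, ⟨h1, h2⟩, h⟩
    refine ⟨h1, _, h2, fun X' E' h3 h4 => ?_⟩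
    obtain ⟨E, F, rfl⟩ := surj E'
    exact h X' E F ⟨h3, h4⟩
  · rintro ⟨h1, E', h2, h⟩
    obtain ⟨E, F, rfl⟩ := surj E'
    exact ⟨E, F, ⟨h1, h2⟩, fun X' E' F' h3 => h X' _ h3.1 h3.2⟩

end RBTLSE

namespace RBTLSE

/-! ### Orthogonal projections and positive quadratic forms. -/

section Projection

variable {κ τ : Type*} [Fintype κ] [Fintype τ] [DecidableEq τ]

/-- The orthogonal projection onto the column space of `N` (of full column rank). -/
noncomputable def proj (N : Matrix κ τ ℝ) : Matrix κ κ ℝ := N * (Nᵀ * N)⁻¹ * Nᵀ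

theorem proj_transpose (N : Matrix κ τ ℝ) : (proj N)ᵀ = proj N := by
  simp only [proj, transpose_mul, transpose_transpose, transpose_nonsing_inv, Matrix.mul_assoc]

theorem proj_mul_self {N : Matrix κ τ ℝ} (hN : IsUnit (Nᵀ * N)) : proj N * N = N := by
  rw [proj, Matrix.mul_assoc, Matrix.mul_assoc, nonsing_inv_mul _ ((isUnit_iff_isUnit_det _).1 hN),
    Matrix.mul_one]

theorem transpose_mul_proj {N : Matrix κ τ ℝ} (hN : IsUnit (Nᵀ * N)) : Nᵀ * proj N = Nᵀ := by
  rw [← proj_transpose, ← transpose_mul, proj_mul_self hN]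

theorem proj_mul_proj {N : Matrix κ τ ℝ} (hN : IsUnit (Nᵀ * N)) : proj N * proj N = proj N := by
  conv_lhs => rhs; rw [proj]
  rw [← Matrix.mul_assoc, ← Matrix.mul_assoc, proj_mul_self hN, proj]

theorem trace_proj {N : Matrix κ τ ℝ} (hN : IsUnit (Nᵀ * N)) :
    (proj N).trace = Fintype.card τ := by
  rw [proj, trace_mul_comm, ← Matrix.mul_assoc, mul_nonsing_inv _ ((isUnit_iff_isUnit_det _).1 hN),
    trace_one]

variable {β : Type*} [Fintype β] [DecidableEq β]

end Projection

theorem trace_conj_eq_sum {κ β : Type*} [Fintype κ] [Fintype β] (Q : Matrix β β ℝ)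
    (Z : Matrix β κ ℝ) : (Zᵀ * Q * Z).trace = ∑ j, Z.col j ⬝ᵥ (Q *ᵥ Z.col j) := by
  simp only [trace, diag_apply, Matrix.mul_assoc]
  refine Finset.sum_congr rfl fun j _ => ?_
  rw [mul_apply, dotProduct]
  refine Finset.sum_congr rfl fun i _ => ?_
  rw [mul_apply]
  rfl

theorem trace_conj_nonneg {κ β : Type*} [Fintype κ] [Fintype β] {Q : Matrix β β ℝ}
    (hQ : ∀ v, v ≠ 0 → 0 < v ⬝ᵥ (Q *ᵥ v)) (Z : Matrix β κ ℝ) : 0 ≤ (Zᵀ * Q * Z).trace := by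
  rw [trace_conj_eq_sum]
  refine Finset.sum_nonneg fun j _ => ?_
  rcases eq_or_ne (Z.col j) 0 with h | h
  · simp [h]
  · exact (hQ _ h).le

theorem eq_zero_of_trace_conj {κ β : Type*} [Fintype κ] [Fintype β] {Q : Matrix β β ℝ}
    (hQ : ∀ v, v ≠ 0 → 0 < v ⬝ᵥ (Q *ᵥ v)) {Z : Matrix β κ ℝ} (h : (Zᵀ * Q * Z).trace ≤ 0) :
    Z = 0 := by
  have hpos : ∀ j, 0 ≤ Z.col j ⬝ᵥ (Q *ᵥ Z.col j) := fun j => by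
    rcases eq_or_ne (Z.col j) 0 with h | h
    · simp [h]
    · exact (hQ _ h).le
  have h0 := le_antisymm h (trace_conj_nonneg hQ Z)
  rw [trace_conj_eq_sum, Finset.sum_eq_zero_iff_of_nonneg fun j _ => hpos j] at h0
  ext i j
  by_contra hij
  have : Z.col j ≠ 0 := fun hc => hij (congrFun hc i)
  exact (hQ _ this).ne' (h0 j (Finset.mem_univ _))

/-! ### A Ky Fan type minimum principle with uniqueness. -/

section KyFan

variable {κ τ β : Type*} [Fintype κ] [Fintype τ] [DecidableEq τ] [Fintype β] [DecidableEq β]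

/-- Since `r = r * r` is symmetric, the trace is a sum of values of the form `Kᵀ m K` at the columns
of `(Kᵀ K)⁻¹ Kᵀ r`. Positivity of the form then settles both its sign and the case of equality. -/
theorem trace_proj_conj {K : Matrix κ β ℝ} {m r : Matrix κ κ ℝ} (rt : rᵀ = r) (rr : r * r = r) :
    (proj K * m * proj K * r).trace =
      (((Kᵀ * K)⁻¹ * Kᵀ * r)ᵀ * (Kᵀ * m * K) * ((Kᵀ * K)⁻¹ * Kᵀ * r)).trace := by
  have : ((Kᵀ * K)⁻¹ * Kᵀ * r)ᵀ * (Kᵀ * m * K) * ((Kᵀ * K)⁻¹ * Kᵀ * r) =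
      r * (proj K * m * proj K * r) := by
    simp only [proj, transpose_mul, transpose_transpose, transpose_nonsing_inv, rt,
      Matrix.mul_assoc]
  rw [this, trace_mul_comm r, Matrix.mul_assoc _ r, rr]

variable [DecidableEq κ]

/-- If the quadratic form of `M` splits along the orthogonal column spaces of `N` and `K`, and is
below `lam` on the first and above it on the second, then `N` spans the subspace of its
dimension with the least trace. -/
theorem trace_proj_le {M : Matrix κ κ ℝ} (hM : Mᵀ = M) {N N' : Matrix κ τ ℝ} {K : Matrix κ β ℝ}
    {lam : ℝ} (hN : IsUnit (Nᵀ * N)) (hN' : IsUnit (N'ᵀ * N')) (hK : IsUnit (Kᵀ * K))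
    (hNK : Nᵀ * K = 0) (hKMN : Kᵀ * M * N = 0)
    (hMK : ∀ v, v ≠ 0 → 0 < v ⬝ᵥ ((Kᵀ * (M - lam • 1) * K) *ᵥ v))
    (hMN : ∀ v, v ≠ 0 → 0 < v ⬝ᵥ ((Nᵀ * (lam • 1 - M) * N) *ᵥ v))
    (hT : proj N * N' + proj K * N' = N') :
    (M * proj N).trace ≤ (M * proj N').trace ∧
      ((M * proj N').trace ≤ (M * proj N).trace → proj N * N' = N') := by
  set p := proj N with hp
  set k := proj K with hk
  set r := proj N' with hr
  have pt : pᵀ = p := proj_transpose N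
  have kt : kᵀ = k := proj_transpose K
  have rt : rᵀ = r := proj_transpose N'
  have pp : p * p = p := proj_mul_proj hN
  have kk : k * k = k := proj_mul_proj hK
  have rr : r * r = r := proj_mul_proj hN'
  have pr : p * r + k * r = r := by
    rw [hr, proj, ← Matrix.mul_assoc, ← Matrix.mul_assoc, ← Matrix.mul_assoc, ← Matrix.mul_assoc,
      ← Matrix.add_mul, ← Matrix.add_mul, hT]
  have rp : r * p + r * k = r := by
    have := congrArg transpose pr
    simpa only [transpose_add, transpose_mul, pt, kt, rt] using this
  -- The two projections have equal rank, so shifting by `lam` changes both traces by the same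
  -- amount.
  set m := M - lam • (1 : Matrix κ κ ℝ) with hm
  have mt : mᵀ = m := by simp [hm, hM]
  have kmp : k * m * p = 0 := by
    have h1 : Kᵀ * m * N = 0 := by
      have : Kᵀ * N = 0 := by
        have := congrArg transpose hNK
        simpa using this
      rw [hm, Matrix.mul_sub, Matrix.sub_mul, hKMN]
      simp [this]
    rw [hk, hp, proj, proj]
    calc _ = K * (Kᵀ * K)⁻¹ * (Kᵀ * m * N) * ((Nᵀ * N)⁻¹ * Nᵀ) := by
          simp only [Matrix.mul_assoc]
      _ = 0 := by rw [h1]; simp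
  have pmk : p * m * k = 0 := by
    have := congrArg transpose kmp
    simpa only [transpose_mul, pt, kt, mt, transpose_zero, Matrix.mul_assoc] using this
  have e1 : (M * r).trace - (M * p).trace = (m * r).trace - (m * p).trace := by
    rw [hm, Matrix.sub_mul, Matrix.sub_mul, trace_sub, trace_sub, Matrix.smul_mul, Matrix.smul_mul,
      Matrix.one_mul, Matrix.one_mul, trace_smul, trace_smul, trace_proj hN, trace_proj hN']
    ring
  -- The cross terms vanish because `m` splits along the ranges of `p` and `k`, and `p + k` acts as
  -- the identity on the range of `r`.
  have e2 : (m * r).trace = (p * m * p * r).trace + (k * m * k * r).trace := by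
    have h1 : r = (p + k) * r * (p + k) := by
      rw [Matrix.add_mul, pr, Matrix.mul_add, rp]
    have h2 : (p + k) * m * (p + k) = p * m * p + k * m * k := by
      simp only [Matrix.add_mul, Matrix.mul_add, kmp, pmk]
      abel
    calc (m * r).trace = (m * ((p + k) * r * (p + k))).trace := by rw [← h1]
      _ = ((p + k) * m * (p + k) * r).trace := by
        rw [← Matrix.mul_assoc, trace_mul_comm]
        simp only [Matrix.mul_assoc]
      _ = _ := by rw [h2, Matrix.add_mul, trace_add]
  have e3 : (m * p).trace = (p * m * p).trace := by
    rw [trace_mul_comm (p * m), ← Matrix.mul_assoc, pp, trace_mul_comm]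
  have e4 := trace_proj_conj (K := K) (m := m) rt rr
  have e5 := trace_proj_conj (K := N) (m := lam • 1 - M) (r := 1 - r)
    (by rw [transpose_sub, rt, transpose_one])
    (by rw [Matrix.mul_sub, Matrix.sub_mul, Matrix.sub_mul, rr]; simp)
  -- With `e2` and `e3`, the gap `tr (m r) - tr (m p)` is the sum of the trace in `e4`, where the
  -- form is above `lam`, and the one in `e5`, where it is below. Both are nonnegative, and equality
  -- makes the first vanish.
  have e6 : (p * (lam • 1 - M) * p * (1 - r)).trace =
      (p * m * p * r).trace - (p * m * p).trace := by
    rw [← neg_sub M, ← hm, ← trace_sub, ← neg_sub (p * m * p)]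
    congr 1
    simp only [Matrix.mul_neg, Matrix.neg_mul, Matrix.mul_sub, Matrix.mul_one]
    abel
  rw [← hk] at e4
  rw [← hp, e6] at e5
  have n4 := trace_conj_nonneg hMK ((Kᵀ * K)⁻¹ * Kᵀ * r)
  have n5 := trace_conj_nonneg hMN ((Nᵀ * N)⁻¹ * Nᵀ * (1 - r))
  refine ⟨by linarith, fun hle => ?_⟩
  have hZ := eq_zero_of_trace_conj (Z := (Kᵀ * K)⁻¹ * Kᵀ * r) hMK (by linarith)
  have hkN : k * N' = 0 := by
    rw [← proj_mul_self hN', ← hr, hk, proj, ← Matrix.mul_assoc, Matrix.mul_assoc K,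
      Matrix.mul_assoc K, hZ]
    simp
  rw [← hT, hkN, add_zero, ← Matrix.mul_assoc, pp]

end KyFan

theorem frob_sq {ι κ : Type*} [Fintype ι] [Fintype κ] (M : Matrix ι κ ℝ) :
    frob M ^ 2 = (Mᵀ * M).trace := by
  rw [frob_eq_sqrt, Real.sq_sqrt (by positivity), Finset.sum_comm]
  simp only [trace, diag_apply, mul_apply, transpose_apply, sq]

theorem frob_nonneg {ι κ : Type*} [Fintype ι] [Fintype κ] (M : Matrix ι κ ℝ) : 0 ≤ frob M := by
  rw [frob_eq_sqrt]
  positivity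

theorem frob_le_frob_iff {ι κ ι' κ' : Type*} [Fintype ι] [Fintype κ] [Fintype ι'] [Fintype κ']
    (M : Matrix ι κ ℝ) (M' : Matrix ι' κ' ℝ) :
    frob M ≤ frob M' ↔ (Mᵀ * M).trace ≤ (M'ᵀ * M').trace := by
  rw [← frob_sq, ← frob_sq, sq_le_sq₀ (frob_nonneg M) (frob_nonneg M')]

theorem isUnit_transpose_mul_self {κ τ : Type*} [Fintype κ] [Fintype τ] [DecidableEq τ]
    {N : Matrix κ τ ℝ} (h : ∀ v, N *ᵥ v = 0 → v = 0) : IsUnit (Nᵀ * N) := by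
  rw [← conjTranspose_eq_transpose_of_trivial]
  refine (Matrix.PosDef.conjTranspose_mul_self N fun v w hvw => ?_).isUnit
  refine sub_eq_zero.1 (h _ ?_)
  rw [mulVec_sub, sub_eq_zero]
  exact hvw

/-! ### Certificates of global optimality. -/

section Certificate

variable {ν μ ι τ β : Type*} [Fintype μ] [Fintype ι] [Fintype τ] [DecidableEq τ]
  [Fintype β]

theorem isUnit_aug (X : Matrix ι τ ℝ) : IsUnit ((aug X)ᵀ * aug X) := by
  refine isUnit_transpose_mul_self fun v hv => ?_
  rw [aug, fromRows_mulVec] at hv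
  funext j
  have := congrFun hv (Sum.inr j)
  simpa [neg_mulVec] using this

theorem trace_transpose_mul_self_mul {κ : Type*} [Fintype κ] (Q : Matrix μ κ ℝ)
    {q : Matrix κ κ ℝ} (qt : qᵀ = q) (qq : q * q = q) :
    ((Q * q)ᵀ * (Q * q)).trace = (Qᵀ * Q * q).trace := by
  rw [transpose_mul, qt, Matrix.mul_assoc, trace_mul_comm q]
  simp only [Matrix.mul_assoc, qq]

/-- The constraint fixes `E` on the range of `N`, where it equals `-P`. By Pythagoras, what `E` does
on the orthogonal complement can only increase its norm. -/
theorem trace_mul_proj_le {κ : Type*} [Fintype κ] [DecidableEq κ] {P E : Matrix μ κ ℝ}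
    {N : Matrix κ τ ℝ} (hN : IsUnit (Nᵀ * N)) (h : (P + E) * N = 0) :
    (Pᵀ * P * proj N).trace ≤ (Eᵀ * E).trace := by
  have hE : E * proj N = -(P * proj N) := by
    have : E * N = -(P * N) := by
      rw [Matrix.add_mul] at h
      exact eq_neg_of_add_eq_zero_right h
    simp only [proj, ← Matrix.mul_assoc, this, Matrix.neg_mul]
  have pp := proj_mul_proj hN
  have pt := proj_transpose N
  have h1 : (Pᵀ * P * proj N).trace = (Eᵀ * E * proj N).trace := by
    rw [← trace_transpose_mul_self_mul P pt pp, ← trace_transpose_mul_self_mul E pt pp, hE,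
      transpose_neg, Matrix.neg_mul, Matrix.mul_neg, neg_neg]
  have h2 : (Eᵀ * E).trace - (Eᵀ * E * proj N).trace =
      ((E * (1 - proj N))ᵀ * (E * (1 - proj N))).trace := by
    have q : (1 - proj N) * (1 - proj N) = 1 - proj N := by
      rw [Matrix.mul_sub, Matrix.sub_mul, Matrix.sub_mul, pp]; simp
    rw [trace_transpose_mul_self_mul E (by rw [transpose_sub, pt, transpose_one]) q,
      Matrix.mul_sub, trace_sub, Matrix.mul_one]
  have h3 : 0 ≤ ((E * (1 - proj N))ᵀ * (E * (1 - proj N))).trace := by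
    rw [← frob_sq]; positivity
  linarith

variable [DecidableEq ι] [DecidableEq β]

/-- A certificate of global optimality: a basis `K` of the part of the kernel of the constraints
orthogonal to `[X; -I]`, such that the objective splits and is larger on `K`. -/
theorem isTLSESol_iff_eq (D : Matrix (ν ⊕ μ) (ι ⊕ τ) ℝ) (X : Matrix ι τ ℝ)
    (K : Matrix (ι ⊕ τ) β ℝ) (lam : ℝ)
    (hSN : D.toRows₁ * aug X = 0) (hSK : D.toRows₁ * K = 0) (hNK : (aug X)ᵀ * K = 0)
    (hKN : (D.toRows₂ * K)ᵀ * (D.toRows₂ * aug X) = 0)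
    (hinj : ∀ R : Matrix (ι ⊕ τ) τ ℝ, (aug X)ᵀ * R = 0 → Kᵀ * R = 0 → D.toRows₁ * R = 0 → R = 0)
    (hMK : ∀ v, v ≠ 0 → 0 < v ⬝ᵥ ((Kᵀ * (D.toRows₂ᵀ * D.toRows₂ - lam • 1) * K) *ᵥ v))
    (hMN : ∀ v, v ≠ 0 →
      0 < v ⬝ᵥ (((aug X)ᵀ * (lam • 1 - D.toRows₂ᵀ * D.toRows₂) * aug X) *ᵥ v))
    (X' : Matrix ι τ ℝ) : IsTLSESol D X' ↔ X' = X := by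
  set P := D.toRows₂
  set S := D.toRows₁
  have hN := isUnit_aug X
  have hK : IsUnit (Kᵀ * K) := by
    refine isUnit_transpose_mul_self fun v hv => ?_
    by_contra hv0
    have := hMK v hv0
    rw [← mulVec_mulVec, hv, mulVec_zero, dotProduct_zero] at this
    exact lt_irrefl _ this
  -- What remains of `aug Y` after both projections is orthogonal to `aug X` and `K` and lies in the
  -- kernel of `S`, so `hinj` makes it zero.
  have hsplit : ∀ Y : Matrix ι τ ℝ, S * aug Y = 0 →
      proj (aug X) * aug Y + proj K * aug Y = aug Y := by
    intro Y hY
    have hKN' : Kᵀ * aug X = 0 := by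
      have := congrArg transpose hNK
      simpa using this
    refine (sub_eq_zero.1 (hinj _ ?_ ?_ ?_)).symm
    · rw [Matrix.mul_sub, Matrix.mul_add, ← Matrix.mul_assoc, transpose_mul_proj hN,
        ← Matrix.mul_assoc, proj, ← Matrix.mul_assoc, ← Matrix.mul_assoc, hNK]
      simp
    · rw [Matrix.mul_sub, Matrix.mul_add, ← Matrix.mul_assoc _ (proj K), transpose_mul_proj hK,
        ← Matrix.mul_assoc, proj, ← Matrix.mul_assoc, ← Matrix.mul_assoc, hKN']
      simp
    · rw [Matrix.mul_sub, Matrix.mul_add, ← Matrix.mul_assoc, proj, ← Matrix.mul_assoc,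
        ← Matrix.mul_assoc, hSN, ← Matrix.mul_assoc, proj, ← Matrix.mul_assoc, ← Matrix.mul_assoc,
        hSK, hY]
      simp
  have hmain : ∀ Y : Matrix ι τ ℝ, S * aug Y = 0 →
      (Pᵀ * P * proj (aug X)).trace ≤ (Pᵀ * P * proj (aug Y)).trace ∧
      ((Pᵀ * P * proj (aug Y)).trace ≤ (Pᵀ * P * proj (aug X)).trace →
        proj (aug X) * aug Y = aug Y) := fun Y hY =>
    trace_proj_le (by simp) hN (isUnit_aug Y) hK hNK
      (by rw [← hKN, transpose_mul]; simp only [Matrix.mul_assoc]) hMK hMN (hsplit Y hY)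
  -- The correction attaining the lower bound of `trace_mul_proj_le`.
  have hfeas : (P + -(P * proj (aug X))) * aug X = 0 := by
    rw [Matrix.add_mul, Matrix.neg_mul, Matrix.mul_assoc, proj_mul_self hN, add_neg_cancel]
  have hval : ((-(P * proj (aug X)))ᵀ * -(P * proj (aug X))).trace =
      (Pᵀ * P * proj (aug X)).trace := by
    rw [transpose_neg, Matrix.neg_mul, Matrix.mul_neg, neg_neg,
      trace_transpose_mul_self_mul P (proj_transpose _) (proj_mul_proj hN)]
  constructor
  · rintro ⟨h1, E, h2, h3⟩
    have h4 := (frob_le_frob_iff _ _).1 (h3 X _ hSN hfeas)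
    rw [hval] at h4
    have h5 := (hmain X' h1).2 ((trace_mul_proj_le (isUnit_aug X') h2).trans h4)
    rw [proj, Matrix.mul_assoc] at h5
    set α := ((aug X)ᵀ * aug X)⁻¹ * ((aug X)ᵀ * aug X')
    have h6 : aug X * α = aug X' := by
      rw [← h5]; simp only [α, Matrix.mul_assoc]
    -- Equal column spaces give `aug X * α = aug X'`; both lower blocks are `-I`, which normalizes
    -- `α`.
    have h7 : α = 1 := by
      ext i j
      have := congrFun (congrFun h6 (Sum.inr i)) j
      simpa [aug, fromRows_mul] using this
    rw [h7, Matrix.mul_one] at h6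
    ext i j
    exact (congrFun (congrFun h6 (Sum.inl i)) j).symm
  · rintro rfl
    refine ⟨hSN, _, hfeas, fun Y E' h1 h2 => ?_⟩
    rw [frob_le_frob_iff, hval]
    exact (hmain Y h1).1.trans (trace_mul_proj_le (isUnit_aug Y) h2)

end Certificate

end RBTLSE

/-! ### Implicit functions and matrix calculus. -/

namespace RBTLSE

/-- In finite dimension an injective partial derivative is invertible. The derivative of the
implicit function is left characterized by the linearized equation, so that no inverse has to be
written down later. -/
theorem exists_implicit_function {E U : Type*} [NormedAddCommGroup E] [NormedSpace ℝ E]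
    [CompleteSpace E] [NormedAddCommGroup U] [NormedSpace ℝ U] [FiniteDimensional ℝ U]
    {F : E × U → U} {F' : E × U →L[ℝ] U} {x₀ : E} {u₀ : U} (hF : HasStrictFDerivAt F F' (x₀, u₀))
    (h0 : F (x₀, u₀) = 0) (hinj : ∀ u, F' (0, u) = 0 → u = 0) :
    ∃ (ψ : E → U) (ψ' : E →L[ℝ] U), HasStrictFDerivAt ψ ψ' x₀ ∧ ψ x₀ = u₀ ∧
      (∀ᶠ x in 𝓝 x₀, F (x, ψ x) = 0) ∧ ∀ v, F' (v, ψ' v) = 0 := by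
  have : CompleteSpace U := FiniteDimensional.complete ℝ U
  have hinv : (F' ∘L .inr ℝ E U).IsInvertible := by
    let e : U ≃ₗ[ℝ] U := LinearEquiv.ofInjectiveEndo (F' ∘L .inr ℝ E U).toLinearMap
      ((injective_iff_map_eq_zero _).2 fun u hu => hinj u (by simpa using hu))
    exact ⟨e.toContinuousLinearEquiv, by ext u; rfl⟩
  have hψ := hF.hasStrictFDerivAt_implicitFunctionOfProdDomain hinv
  have hev := hF.eventually_apply_implicitFunctionOfProdDomain hinv
  have hψ0 : hF.implicitFunctionOfProdDomain hinv x₀ = u₀ :=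
    (hF.eventually_apply_eq_iff_implicitFunctionOfProdDomain hinv).self_of_nhds.mp rfl
  set ψ := hF.implicitFunctionOfProdDomain hinv
  simp only [h0] at hev
  refine ⟨ψ, _, hψ, hψ0, hev, fun v => ?_⟩
  have hsurj := hinv.surjective
  have : F' (v, (-(F' ∘L .inr ℝ E U).inverse ∘L (F' ∘L .inl ℝ E U)) v) =
      (F' ∘L .inl ℝ E U) v + (F' ∘L .inr ℝ E U)
        ((-(F' ∘L .inr ℝ E U).inverse ∘L (F' ∘L .inl ℝ E U)) v) := by
    simp [← map_add]
  rw [this]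
  obtain ⟨e, he⟩ := hinv
  rw [← he]
  simp

open scoped Matrix.Norms.Frobenius

section Calculus

variable {E : Type*} [NormedAddCommGroup E] [NormedSpace ℝ E]
  {l m n : Type*} [Fintype l] [Fintype m] [Fintype n]

/-- Matrix multiplication as a continuous bilinear map. -/
noncomputable def mulCLM (l m n : Type*) [Fintype l] [Fintype m] [Fintype n] :
    Matrix l m ℝ →L[ℝ] Matrix m n ℝ →L[ℝ] Matrix l n ℝ :=
  (LinearMap.mk₂ ℝ (fun (A : Matrix l m ℝ) (B : Matrix m n ℝ) => A * B) Matrix.add_mul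
    (fun c A B => Matrix.smul_mul c A B) Matrix.mul_add
    fun c A B => Matrix.mul_smul A c B).toContinuousBilinearMap

/-- The derivative of a product of matrix-valued functions. -/
noncomputable def mulDeriv (A : Matrix l m ℝ) (B : Matrix m n ℝ) (A' : E →L[ℝ] Matrix l m ℝ)
    (B' : E →L[ℝ] Matrix m n ℝ) : E →L[ℝ] Matrix l n ℝ :=
  (mulCLM l m n).precompR E A B' + (mulCLM l m n).precompL E A' B

theorem hasStrictFDerivAt_matrix_mul {f : E → Matrix l m ℝ} {g : E → Matrix m n ℝ}
    {f' : E →L[ℝ] Matrix l m ℝ} {g' : E →L[ℝ] Matrix m n ℝ} {x : E}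
    (hf : HasStrictFDerivAt f f' x) (hg : HasStrictFDerivAt g g' x) :
    HasStrictFDerivAt (fun y => f y * g y) (mulDeriv (f x) (g x) f' g') x :=
  (mulCLM l m n).hasStrictFDerivAt_of_bilinear hf hg

/-- Transposition as a continuous linear map. -/
noncomputable def transposeCLM (l m : Type*) [Fintype l] [Fintype m] :
    Matrix l m ℝ →L[ℝ] Matrix m l ℝ :=
  (transposeLinearEquiv l m ℝ ℝ).toLinearMap.toContinuousLinearMap

theorem hasStrictFDerivAt_matrix_transpose {f : E → Matrix l m ℝ}
    {f' : E →L[ℝ] Matrix l m ℝ} {x : E} (hf : HasStrictFDerivAt f f' x) :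
    HasStrictFDerivAt (fun y => (f y)ᵀ) (transposeCLM l m ∘L f') x :=
  (transposeCLM l m).hasStrictFDerivAt.comp x hf

/-- The upper block as a continuous linear map. -/
noncomputable def toRows₁CLM (l m n : Type*) [Fintype l] [Fintype m] [Fintype n] :
    Matrix (l ⊕ m) n ℝ →L[ℝ] Matrix l n ℝ :=
  LinearMap.toContinuousLinearMap
    { toFun := fun A => A.toRows₁, map_add' := fun _ _ => rfl, map_smul' := fun _ _ => rfl }

/-- The lower block as a continuous linear map. -/
noncomputable def toRows₂CLM (l m n : Type*) [Fintype l] [Fintype m] [Fintype n] :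
    Matrix (l ⊕ m) n ℝ →L[ℝ] Matrix m n ℝ :=
  LinearMap.toContinuousLinearMap
    { toFun := fun A => A.toRows₂, map_add' := fun _ _ => rfl, map_smul' := fun _ _ => rfl }

end Calculus

/-! ### Adapted bases and the system of optimality equations. -/

/-- Orthonormal bases adapted to the data `D = [S; P]`: `S = U_s diag(s) V_sᵀ`, and `P` acts on
the kernel of `S`, with orthonormal basis `[V₁, V₂]`, by `P V₁ = U₁ diag(σ₁)`,
`P V₂ = U₂ diag(σ₂)`; moreover the lower block of `V₂` has the inverse `-Y`. -/
structure AdaptedBasis {ν μ ι τ β : Type*} [Fintype ν] [DecidableEq ν] [Fintype μ] [Fintype ι]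
    [DecidableEq ι] [Fintype τ] [DecidableEq τ] [Fintype β] [DecidableEq β]
    (D : Matrix (ν ⊕ μ) (ι ⊕ τ) ℝ) (Us : Matrix ν ν ℝ) (s : ν → ℝ) (Vs : Matrix (ι ⊕ τ) ν ℝ)
    (V1 : Matrix (ι ⊕ τ) β ℝ) (V2 : Matrix (ι ⊕ τ) τ ℝ) (U1 : Matrix μ β ℝ) (U2 : Matrix μ τ ℝ)
    (σ1 : β → ℝ) (σ2 : τ → ℝ) (Y : Matrix τ τ ℝ) : Prop where
  Vs_Vs : Vsᵀ * Vs = 1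
  Vs_V1 : Vsᵀ * V1 = 0
  Vs_V2 : Vsᵀ * V2 = 0
  V1_V1 : V1ᵀ * V1 = 1
  V1_V2 : V1ᵀ * V2 = 0
  V2_V2 : V2ᵀ * V2 = 1
  complete : Vs * Vsᵀ + V1 * V1ᵀ + V2 * V2ᵀ = 1
  Us_Us : Usᵀ * Us = 1
  s_ne : ∀ i, s i ≠ 0
  S_eq : D.toRows₁ = Us * diagonal s * Vsᵀ
  U1_U1 : U1ᵀ * U1 = 1
  U1_U2 : U1ᵀ * U2 = 0
  U2_U2 : U2ᵀ * U2 = 1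
  P_V1 : D.toRows₂ * V1 = U1 * diagonal σ1
  P_V2 : D.toRows₂ * V2 = U2 * diagonal σ2
  gap : ∀ i j, σ2 j < σ1 i
  pos : ∀ j, 0 < σ2 j
  V22_Y : V2.toRows₂ * Y = -1

section Riccati

variable {ν μ ι τ β : Type*} [Fintype ν] [Fintype μ] [Fintype ι] [DecidableEq ι] [Fintype τ]
  [Fintype β]

/-- The unknowns `(a, b, e, f)` of the system that characterizes the perturbed solution. -/
abbrev Unknown (ν τ β : Type*) : Type _ :=
  Matrix ν τ ℝ × Matrix β τ ℝ × Matrix τ β ℝ × Matrix ν β ℝ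

variable (D : Matrix (ν ⊕ μ) (ι ⊕ τ) ℝ) (Vs : Matrix (ι ⊕ τ) ν ℝ)
    (V1 : Matrix (ι ⊕ τ) β ℝ) (V2 : Matrix (ι ⊕ τ) τ ℝ) (Y : Matrix τ τ ℝ)

/-- The solution of the unperturbed problem. -/
def baseSol : Matrix ι τ ℝ := (V2 * Y).toRows₁

/-- The displacement of the solution with coordinates `a`, `b`. -/
def displacement (u : Unknown ν τ β) : Matrix ι τ ℝ :=
  fromCols (1 : Matrix ι ι ℝ) (baseSol V2 Y) * (Vs * u.1 + V1 * u.2.1) * Y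

theorem displacement_add (u w : Unknown ν τ β) : displacement Vs V1 V2 Y (u + w) =
    displacement Vs V1 V2 Y u + displacement Vs V1 V2 Y w := by
  simp only [displacement, Prod.fst_add, Prod.snd_add, Matrix.mul_add, Matrix.add_mul]
  abel

theorem displacement_smul (c : ℝ) (u : Unknown ν τ β) : displacement Vs V1 V2 Y (c • u) =
    c • displacement Vs V1 V2 Y u := by
  simp only [displacement, Prod.smul_fst, Prod.smul_snd, Matrix.mul_smul, ← smul_add,
    Matrix.smul_mul]

/-- The displaced basis `V₁ + V₂ e + V_s f`. -/
def kerBasis (u : Unknown ν τ β) : Matrix (ι ⊕ τ) β ℝ := V1 + (V2 * u.2.2.1 + Vs * u.2.2.2)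

variable [DecidableEq τ]

/-- The system of equations expressing that `[X; -I]` and the displaced basis `K` split the kernel
of the constraints and that the objective is stationary. -/
def system (z : Matrix (ν ⊕ μ) (ι ⊕ τ) ℝ × Unknown ν τ β) : Unknown ν τ β :=
  let N := aug (baseSol V2 Y + displacement Vs V1 V2 Y z.2)
  let K := kerBasis Vs V1 V2 z.2
  (z.1.toRows₁ * N, (z.1.toRows₂ * K)ᵀ * (z.1.toRows₂ * N), Nᵀ * K, z.1.toRows₁ * K)

theorem aug_add {ι τ : Type*} [DecidableEq τ] (X Z : Matrix ι τ ℝ) : aug (X + Z) = aug X + fromRows Z 0 := by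
  ext (i | i) j <;> simp [aug]

/-- Both `N` and `K` are affine in the unknowns, so only the product rule is involved. The base
point is `u = 0`, where `N = aug (baseSol V2 Y)` and `K = V1`. -/
theorem hasStrictFDerivAt_system : ∃ F' : (Matrix (ν ⊕ μ) (ι ⊕ τ) ℝ × Unknown ν τ β) →L[ℝ]
      Unknown ν τ β,
    HasStrictFDerivAt (system Vs V1 V2 Y) F' (D, 0) ∧ ∀ Δ u, F' (Δ, u) =
      let N := aug (baseSol V2 Y)
      let dN : Matrix (ι ⊕ τ) τ ℝ := fromRows (displacement Vs V1 V2 Y u) 0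
      let dK := V2 * u.2.2.1 + Vs * u.2.2.2
      (D.toRows₁ * dN + Δ.toRows₁ * N,
       (D.toRows₂ * V1)ᵀ * (D.toRows₂ * dN + Δ.toRows₂ * N) +
         (D.toRows₂ * dK + Δ.toRows₂ * V1)ᵀ * (D.toRows₂ * N),
       Nᵀ * dK + dNᵀ * V1, D.toRows₁ * dK + Δ.toRows₁ * V1) := by
  let nL : (Matrix (ν ⊕ μ) (ι ⊕ τ) ℝ × Unknown ν τ β) →ₗ[ℝ] Matrix (ι ⊕ τ) τ ℝ :=
    { toFun := fun z => fromRows (displacement Vs V1 V2 Y z.2) 0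
      map_add' := fun z w => by
        rw [Prod.snd_add, displacement_add]
        ext (i | i) j <;> simp
      map_smul' := fun c z => by
        rw [Prod.smul_snd, displacement_smul]
        ext (i | i) j <;> simp }
  let kL : (Matrix (ν ⊕ μ) (ι ⊕ τ) ℝ × Unknown ν τ β) →ₗ[ℝ] Matrix (ι ⊕ τ) β ℝ :=
    { toFun := fun z => V2 * z.2.2.2.1 + Vs * z.2.2.2.2
      map_add' := fun z w => by
        simp only [Prod.snd_add, Prod.fst_add, Matrix.mul_add]; abel
      map_smul' := fun c z => by
        simp only [Prod.smul_snd, Prod.smul_fst, Matrix.mul_smul, smul_add, RingHom.id_apply] }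
  have hn : HasStrictFDerivAt
      (fun z : Matrix (ν ⊕ μ) (ι ⊕ τ) ℝ × Unknown ν τ β => aug (baseSol V2 Y + displacement Vs V1 V2 Y z.2))
      nL.toContinuousLinearMap (D, 0) := by
    simp only [aug_add]
    exact nL.toContinuousLinearMap.hasStrictFDerivAt.const_add _
  have hk : HasStrictFDerivAt
      (fun z : Matrix (ν ⊕ μ) (ι ⊕ τ) ℝ × Unknown ν τ β => kerBasis Vs V1 V2 z.2)
      kL.toContinuousLinearMap (D, 0) :=
    kL.toContinuousLinearMap.hasStrictFDerivAt.const_add _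
  let sL : (Matrix (ν ⊕ μ) (ι ⊕ τ) ℝ × Unknown ν τ β) →L[ℝ] _ :=
    toRows₁CLM ν μ (ι ⊕ τ) ∘L ContinuousLinearMap.fst ℝ _ _
  have hs : HasStrictFDerivAt
      (fun z : Matrix (ν ⊕ μ) (ι ⊕ τ) ℝ × Unknown ν τ β => z.1.toRows₁) sL (D, 0) :=
    sL.hasStrictFDerivAt
  let pL : (Matrix (ν ⊕ μ) (ι ⊕ τ) ℝ × Unknown ν τ β) →L[ℝ] _ :=
    toRows₂CLM ν μ (ι ⊕ τ) ∘L ContinuousLinearMap.fst ℝ _ _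
  have hp : HasStrictFDerivAt
      (fun z : Matrix (ν ⊕ μ) (ι ⊕ τ) ℝ × Unknown ν τ β => z.1.toRows₂) pL (D, 0) :=
    pL.hasStrictFDerivAt
  have hd0 : displacement Vs V1 V2 Y 0 = 0 := by simp [displacement]
  have hk0 : kerBasis Vs V1 V2 (0 : Unknown ν τ β) = V1 := by simp [kerBasis]
  have h := (hasStrictFDerivAt_matrix_mul hs hn).prodMk
    ((hasStrictFDerivAt_matrix_mul
      (hasStrictFDerivAt_matrix_transpose (hasStrictFDerivAt_matrix_mul hp hk))
      (hasStrictFDerivAt_matrix_mul hp hn)).prodMk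
    ((hasStrictFDerivAt_matrix_mul (hasStrictFDerivAt_matrix_transpose hn) hk).prodMk
      (hasStrictFDerivAt_matrix_mul hs hk)))
  refine ⟨_, h, fun Δ u => ?_⟩
  simp only [hd0, hk0, add_zero]
  rfl

end Riccati

end RBTLSE

namespace RBTLSE

/-! ### Positive definiteness as an open condition. -/

section PositiveForm

variable {m n : Type*} [Fintype m] [Fintype n]

/-- Positivity is an open condition at each point of the unit sphere, compactness makes it uniform
there, and homogeneity extends it to all nonzero vectors. -/
theorem eventually_form_pos {E : Type*} [TopologicalSpace E] {x₀ : E} {Q : E → Matrix n n ℝ}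
    (hQ : ContinuousAt Q x₀) (h : ∀ v, v ≠ 0 → 0 < v ⬝ᵥ (Q x₀ *ᵥ v)) :
    ∀ᶠ x in 𝓝 x₀, ∀ v, v ≠ 0 → 0 < v ⬝ᵥ (Q x *ᵥ v) := by
  have hc : Continuous fun z : Matrix n n ℝ × (n → ℝ) => z.2 ⬝ᵥ (z.1 *ᵥ z.2) :=
    continuous_snd.dotProduct (continuous_fst.matrix_mulVec continuous_snd)
  have key : ∀ᶠ A in 𝓝 (Q x₀), ∀ v ∈ Metric.sphere (0 : n → ℝ) 1, 0 < v ⬝ᵥ (A *ᵥ v) := by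
    refine (isCompact_sphere _ _).eventually_forall_of_forall_eventually fun v hv => ?_
    have hv0 : v ≠ 0 := by
      rintro rfl
      simp at hv
    exact hc.continuousAt.eventually (lt_mem_nhds (h v hv0))
  filter_upwards [hQ.eventually key] with x hx v hv
  have hv' : 0 < ‖v‖ := norm_pos_iff.2 hv
  have := hx (‖v‖⁻¹ • v) (by
    rw [mem_sphere_zero_iff_norm, norm_smul, norm_inv, norm_norm, inv_mul_cancel₀ hv'.ne'])
  rw [mulVec_smul, smul_dotProduct, dotProduct_smul, smul_eq_mul, smul_eq_mul] at this
  have h2 : 0 < ‖v‖⁻¹ := inv_pos.2 hv'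
  exact pos_of_mul_pos_right (pos_of_mul_pos_right this h2.le) h2.le

theorem dotProduct_conj_mulVec (A : Matrix m n ℝ) (Q : Matrix m m ℝ) (v : n → ℝ) :
    v ⬝ᵥ ((Aᵀ * Q * A) *ᵥ v) = (A *ᵥ v) ⬝ᵥ (Q *ᵥ (A *ᵥ v)) := by
  rw [← mulVec_mulVec, ← mulVec_mulVec, dotProduct_mulVec, vecMul_transpose]

theorem diagonal_form_pos [DecidableEq n] {w : n → ℝ} (hw : ∀ i, 0 < w i) (v : n → ℝ)
    (hv : v ≠ 0) : 0 < v ⬝ᵥ (diagonal w *ᵥ v) := by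
  obtain ⟨i, hi⟩ := Function.ne_iff.1 hv
  simp only [dotProduct, mulVec_diagonal]
  refine Finset.sum_pos' (fun j _ => ?_) ⟨i, Finset.mem_univ _, ?_⟩
  · have := mul_nonneg (hw j).le (mul_self_nonneg (v j)); linarith
  · have := mul_pos (hw i) (mul_self_pos.2 hi); linarith

end PositiveForm

open scoped Matrix.Norms.Frobenius

/-! ### Solving the linearized system. -/

section Perturbation

variable {ν μ ι τ β : Type*} [Fintype ν] [DecidableEq ν] [Fintype μ] [Fintype ι]
  [DecidableEq ι] [Fintype τ] [DecidableEq τ] [Fintype β] [DecidableEq β]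

namespace AdaptedBasis

variable {D : Matrix (ν ⊕ μ) (ι ⊕ τ) ℝ} {Us : Matrix ν ν ℝ} {s : ν → ℝ} {Vs : Matrix (ι ⊕ τ) ν ℝ}
    {V1 : Matrix (ι ⊕ τ) β ℝ} {V2 : Matrix (ι ⊕ τ) τ ℝ} {U1 : Matrix μ β ℝ} {U2 : Matrix μ τ ℝ}
    {σ1 : β → ℝ} {σ2 : τ → ℝ} {Y : Matrix τ τ ℝ}
    (h : AdaptedBasis D Us s Vs V1 V2 U1 U2 σ1 σ2 Y)

include h

theorem aug_baseSol : aug (baseSol V2 Y) = V2 * Y := by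
  have := h.V22_Y
  ext (i | i) j
  · rfl
  · exact (congrFun (congrFun this i) j).symm

theorem eq_zero_of_mul_Y {κ : Type*} {M : Matrix κ τ ℝ} (hM : M * Y = 0) : M = 0 := by
  have h1 : -V2.toRows₂ * Y = 1 := by rw [Matrix.neg_mul, h.V22_Y, neg_neg]
  have h2 := mul_eq_one_comm.1 h1
  rw [← Matrix.mul_one M, ← h2, ← Matrix.mul_assoc, hM, Matrix.zero_mul]

/-- Adding `[X; -I]` times the lower block of `Z` clears that block, and `[X; -I] = V2 * Y`. So a
change of `X` alone realizes any `Z` up to columns of `V2`. -/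
theorem fromRows_mul_zero {κ : Type*} (Z : Matrix (ι ⊕ τ) κ ℝ) :
    fromRows (fromCols (1 : Matrix ι ι ℝ) (baseSol V2 Y) * Z) 0 =
      Z + V2 * (Y * Z.toRows₂) := by
  rw [← Matrix.mul_assoc, ← h.aug_baseSol]
  conv_lhs => rw [← fromRows_toRows Z]
  rw [fromCols_mul_fromRows, aug, fromRows_mul]
  ext (i | i) j <;> simp

theorem S_Vs : D.toRows₁ * Vs = Us * diagonal s := by
  rw [h.S_eq, Matrix.mul_assoc, h.Vs_Vs, Matrix.mul_one]

theorem S_V1 : D.toRows₁ * V1 = 0 := by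
  rw [h.S_eq, Matrix.mul_assoc, h.Vs_V1, Matrix.mul_zero]

theorem S_V2 : D.toRows₁ * V2 = 0 := by
  rw [h.S_eq, Matrix.mul_assoc, h.Vs_V2, Matrix.mul_zero]

theorem V2_Vs : V2ᵀ * Vs = 0 := by
  simpa using congrArg transpose h.Vs_V2

theorem V2_V1 : V2ᵀ * V1 = 0 := by
  simpa using congrArg transpose h.V1_V2

theorem solve_diagonal {κ : Type*} [Fintype κ] {x : Matrix ν κ ℝ} {y : Matrix ν κ ℝ}
    (hx : Us * diagonal s * x + y = 0) : x = -(diagonal s⁻¹ * Usᵀ * y) := by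
  have hs : diagonal s⁻¹ * diagonal s = (1 : Matrix ν ν ℝ) := by
    rw [diagonal_mul_diagonal, ← diagonal_one]
    congr 1
    funext i
    exact inv_mul_cancel₀ (h.s_ne i)
  have h1 : diagonal s⁻¹ * Usᵀ * (Us * diagonal s * x) = x := by
    calc _ = diagonal s⁻¹ * (Usᵀ * Us) * diagonal s * x := by simp only [Matrix.mul_assoc]
      _ = x := by rw [h.Us_Us, Matrix.mul_one, hs, Matrix.one_mul]
  rw [← h1, eq_neg_of_add_eq_zero_left hx, Matrix.mul_neg]

/-- The solution of the linearized system. -/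
theorem linearized {Δ : Matrix (ν ⊕ μ) (ι ⊕ τ) ℝ} {u : Unknown ν τ β} {dN : Matrix (ι ⊕ τ) τ ℝ}
    (hdN : dN = fromRows (displacement Vs V1 V2 Y u) 0)
    (e1 : D.toRows₁ * dN + Δ.toRows₁ * aug (baseSol V2 Y) = 0)
    (e2 : (D.toRows₂ * V1)ᵀ * (D.toRows₂ * dN + Δ.toRows₂ * aug (baseSol V2 Y)) +
      (D.toRows₂ * (V2 * u.2.2.1 + Vs * u.2.2.2) + Δ.toRows₂ * V1)ᵀ *
        (D.toRows₂ * aug (baseSol V2 Y)) = 0)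
    (e3 : (aug (baseSol V2 Y))ᵀ * (V2 * u.2.2.1 + Vs * u.2.2.2) + dNᵀ * V1 = 0)
    (e4 : D.toRows₁ * (V2 * u.2.2.1 + Vs * u.2.2.2) + Δ.toRows₁ * V1 = 0) :
    u.1 = -(diagonal s⁻¹ * Usᵀ * (Δ.toRows₁ * V2)) ∧
    u.2.2.2 = -(diagonal s⁻¹ * Usᵀ * (Δ.toRows₁ * V1)) ∧ u.2.2.1 = -(u.2.1)ᵀ ∧
    diagonal σ1 * diagonal σ1 * u.2.1 - u.2.1 * diagonal σ2 * diagonal σ2 =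
      -(diagonal σ1 * U1ᵀ *
          ((Δ.toRows₂ - D.toRows₂ * (Vs * diagonal s⁻¹ * Usᵀ) * Δ.toRows₁) * V2) +
        ((Δ.toRows₂ - D.toRows₂ * (Vs * diagonal s⁻¹ * Usᵀ) * Δ.toRows₁) * V1)ᵀ *
          U2 * diagonal σ2) := by
  obtain ⟨a, b, e, f⟩ := u
  dsimp only at *
  -- The component `c` along `V2` never matters: it is killed by `S`, is orthogonal to `V1`, and has
  -- an image under `P` orthogonal to that of `V1`.
  have hdN' : ∃ c : Matrix τ τ ℝ, dN = (Vs * a + V1 * b) * Y + V2 * c := by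
    refine ⟨Y * ((Vs * a + V1 * b) * Y).toRows₂, ?_⟩
    rw [hdN, displacement, Matrix.mul_assoc, h.fromRows_mul_zero]
  obtain ⟨c, hc⟩ := hdN'
  rw [h.aug_baseSol] at e1 e2 e3
  subst hc
  clear hdN
  have ha : a = -(diagonal s⁻¹ * Usᵀ * (Δ.toRows₁ * V2)) := by
    refine h.solve_diagonal (h.eq_zero_of_mul_Y ?_)
    rw [← e1, ← h.S_Vs]
    have : D.toRows₁ * ((Vs * a + V1 * b) * Y + V2 * c) = D.toRows₁ * Vs * a * Y := by
      rw [Matrix.mul_add, ← Matrix.mul_assoc, ← Matrix.mul_assoc, Matrix.mul_add, h.S_V2,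
        ← Matrix.mul_assoc, ← Matrix.mul_assoc, h.S_V1]
      simp
    rw [this, Matrix.add_mul, Matrix.mul_assoc Δ.toRows₁]
  have hf : f = -(diagonal s⁻¹ * Usᵀ * (Δ.toRows₁ * V1)) := by
    refine h.solve_diagonal ?_
    rw [← e4, ← h.S_Vs, Matrix.mul_add, ← Matrix.mul_assoc, ← Matrix.mul_assoc, h.S_V2,
      Matrix.zero_mul, zero_add]
  have he : e = -bᵀ := by
    have h1 : (V2 * Y)ᵀ * (V2 * e + Vs * f) = Yᵀ * e := by
      rw [transpose_mul, Matrix.mul_assoc, Matrix.mul_add, ← Matrix.mul_assoc V2ᵀ,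
        ← Matrix.mul_assoc V2ᵀ, h.V2_V2, h.V2_Vs]
      simp
    have h2 : ((Vs * a + V1 * b) * Y + V2 * c)ᵀ * V1 = Yᵀ * bᵀ := by
      simp only [transpose_add, transpose_mul, Matrix.add_mul, Matrix.mul_assoc,
        h.Vs_V1, h.V1_V1, h.V2_V1]
      simp
    rw [h1, h2, ← Matrix.mul_add] at e3
    have h3 : (e + bᵀ)ᵀ * Y = 0 := by simpa using congrArg transpose e3
    have h4 := congrArg transpose (h.eq_zero_of_mul_Y h3)
    rw [transpose_transpose, transpose_zero] at h4
    exact eq_neg_of_add_eq_zero_left h4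
  refine ⟨ha, hf, he, ?_⟩
  set P := D.toRows₂
  set W := Vs * diagonal s⁻¹ * Usᵀ with hW
  have hPa : P * Vs * a = -(P * W * Δ.toRows₁ * V2) := by
    rw [ha, hW]; simp only [Matrix.mul_neg, Matrix.mul_assoc]
  have hPf : P * Vs * f = -(P * W * Δ.toRows₁ * V1) := by
    rw [hf, hW]; simp only [Matrix.mul_neg, Matrix.mul_assoc]
  -- The two halves of the stationarity equation. The first contributes `Σ₁² b`; in the second, `e =
  -- -bᵀ` yields `-b Σ₂²`. Substituting `a` and `f` replaces the change of `P` by `ΔP - P S† ΔS` in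
  -- both.
  have t1 : (P * V1)ᵀ * (P * ((Vs * a + V1 * b) * Y + V2 * c) + Δ.toRows₂ * (V2 * Y)) =
      (diagonal σ1 * U1ᵀ * ((Δ.toRows₂ - P * W * Δ.toRows₁) * V2) +
        diagonal σ1 * diagonal σ1 * b) * Y := by
    have x1 : P * ((Vs * a + V1 * b) * Y + V2 * c) + Δ.toRows₂ * (V2 * Y) =
        (Δ.toRows₂ - P * W * Δ.toRows₁) * V2 * Y + U1 * (diagonal σ1 * b * Y) +
          U2 * (diagonal σ2 * c) := by
      have : P * ((Vs * a + V1 * b) * Y + V2 * c) =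
          P * Vs * a * Y + P * V1 * b * Y + P * V2 * c := by
        simp only [Matrix.mul_add, Matrix.add_mul, Matrix.mul_assoc]
      rw [this, hPa, h.P_V1, h.P_V2]
      simp only [Matrix.sub_mul, Matrix.neg_mul, Matrix.mul_assoc]
      abel
    rw [x1, h.P_V1, transpose_mul, diagonal_transpose, Matrix.mul_add, Matrix.mul_add,
      ← Matrix.mul_assoc _ U2, Matrix.mul_assoc _ U1ᵀ U2, h.U1_U2, ← Matrix.mul_assoc _ U1,
      Matrix.mul_assoc _ U1ᵀ U1, h.U1_U1]
    simp only [Matrix.add_mul, Matrix.mul_assoc, Matrix.one_mul, Matrix.mul_zero, Matrix.zero_mul,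
      add_zero]
  have t2 : (P * (V2 * e + Vs * f) + Δ.toRows₂ * V1)ᵀ * (P * (V2 * Y)) =
      (((Δ.toRows₂ - P * W * Δ.toRows₁) * V1)ᵀ * U2 * diagonal σ2 -
        b * diagonal σ2 * diagonal σ2) * Y := by
    have x1 : P * (V2 * e + Vs * f) + Δ.toRows₂ * V1 =
        (Δ.toRows₂ - P * W * Δ.toRows₁) * V1 - U2 * (diagonal σ2 * bᵀ) := by
      have : P * (V2 * e + Vs * f) = P * V2 * e + P * Vs * f := by
        simp only [Matrix.mul_add, Matrix.mul_assoc]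
      rw [this, hPf, h.P_V2, he]
      simp only [Matrix.sub_mul, Matrix.mul_neg, Matrix.mul_assoc]
      abel
    have x2 : P * (V2 * Y) = U2 * (diagonal σ2 * Y) := by
      rw [← Matrix.mul_assoc, h.P_V2, Matrix.mul_assoc]
    have x3 : U2ᵀ * (U2 * (diagonal σ2 * Y)) = diagonal σ2 * Y := by
      rw [← Matrix.mul_assoc, h.U2_U2, Matrix.one_mul]
    rw [x1, x2, transpose_sub, Matrix.sub_mul, transpose_mul U2, Matrix.mul_assoc _ U2ᵀ, x3]
    simp only [Matrix.sub_mul, transpose_mul, diagonal_transpose, transpose_transpose,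
      Matrix.mul_assoc]
  rw [t1, t2, ← Matrix.add_mul] at e2
  have := h.eq_zero_of_mul_Y e2
  rw [← sub_eq_zero, ← this]
  abel

theorem sq_gap (i : β) (j : τ) : σ2 j ^ 2 < σ1 i ^ 2 :=
  pow_lt_pow_left₀ (h.gap i j) (h.pos j).le two_ne_zero

/-- The Sylvester map is diagonal in the entries, with factors `σ1 i ^ 2 - σ2 j ^ 2`, positive by
the gap. -/
theorem sylvester_injective {b : Matrix β τ ℝ}
    (hb : diagonal σ1 * diagonal σ1 * b - b * diagonal σ2 * diagonal σ2 = 0) : b = 0 := by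
  ext i j
  have := congrFun (congrFun hb i) j
  simp only [diagonal_mul_diagonal, Matrix.mul_assoc, Matrix.sub_apply, diagonal_mul, mul_diagonal,
    Matrix.zero_apply] at this
  have h1 : (σ1 i ^ 2 - σ2 j ^ 2) * b i j = 0 := by rw [← this]; ring
  exact (mul_eq_zero.1 h1).resolve_left (sub_pos.2 (h.sq_gap i j)).ne'

end AdaptedBasis

end Perturbation

end RBTLSE

namespace RBTLSE

open scoped Matrix.Norms.Frobenius

/-! ### Persistence of the certificate and the solution map. -/

section Continuity

variable {E : Type*} [TopologicalSpace E] {l m n : Type*} [Fintype l] [Fintype m] [Fintype n]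
  {x : E}

theorem continuousAt_aug {m n : Type*} [Fintype m] [Fintype n] [DecidableEq n] {f : E → Matrix m n ℝ}
    (hf : ContinuousAt f x) : ContinuousAt (fun y => aug (f y)) x := by
  have h : Continuous (aug : Matrix m n ℝ → Matrix (m ⊕ n) n ℝ) := by
    refine continuous_matrix fun i j => ?_
    rcases i with i | i
    · exact continuous_id.matrix_elem i j
    · exact continuous_const
  exact h.continuousAt.comp hf

theorem continuousAt_matrix_mul {f : E → Matrix l m ℝ} {g : E → Matrix m n ℝ}
    (hf : ContinuousAt f x) (hg : ContinuousAt g x) : ContinuousAt (fun y => f y * g y) x :=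
  ContinuousAt.comp (g := fun p : Matrix l m ℝ × Matrix m n ℝ => p.1 * p.2)
    (f := fun y => (f y, g y))
    (mulCLM l m n).isBoundedBilinearMap.continuous.continuousAt (hf.prodMk hg)

theorem continuousAt_matrix_transpose {f : E → Matrix l m ℝ} (hf : ContinuousAt f x) :
    ContinuousAt (fun y => (f y)ᵀ) x :=
  (transposeCLM l m).continuous.continuousAt.comp hf

end Continuity

theorem gram_form {m n : Type*} [Fintype m] [Fintype n] (A : Matrix m n ℝ) (v : n → ℝ) :
    v ⬝ᵥ ((Aᵀ * A) *ᵥ v) = (A *ᵥ v) ⬝ᵥ (A *ᵥ v) := by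
  rw [← mulVec_mulVec, dotProduct_mulVec, vecMul_transpose]

theorem gram_form_nonneg {m n : Type*} [Fintype m] [Fintype n] (A : Matrix m n ℝ) (v : n → ℝ) :
    0 ≤ v ⬝ᵥ ((Aᵀ * A) *ᵥ v) := by
  rw [gram_form]
  exact Finset.sum_nonneg fun i _ => mul_self_nonneg _

theorem mulVec_eq_zero_of_gram_form {m n : Type*} [Fintype m] [Fintype n] {A : Matrix m n ℝ}
    {v : n → ℝ} (h : v ⬝ᵥ ((Aᵀ * A) *ᵥ v) = 0) : A *ᵥ v = 0 := by
  rw [gram_form] at h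
  exact dotProduct_self_eq_zero.1 h

section Perturbation

variable {ν μ ι τ β : Type*} [Fintype ν] [DecidableEq ν] [Fintype μ] [Fintype ι]
  [DecidableEq ι] [Fintype τ] [DecidableEq τ] [Fintype β] [DecidableEq β]

namespace AdaptedBasis

variable {D : Matrix (ν ⊕ μ) (ι ⊕ τ) ℝ} {Us : Matrix ν ν ℝ} {s : ν → ℝ} {Vs : Matrix (ι ⊕ τ) ν ℝ}
    {V1 : Matrix (ι ⊕ τ) β ℝ} {V2 : Matrix (ι ⊕ τ) τ ℝ} {U1 : Matrix μ β ℝ} {U2 : Matrix μ τ ℝ}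
    {σ1 : β → ℝ} {σ2 : τ → ℝ} {Y : Matrix τ τ ℝ}
    (h : AdaptedBasis D Us s Vs V1 V2 U1 U2 σ1 σ2 Y)

include h

theorem Y_mulVec_ne_zero {v : τ → ℝ} (hv : v ≠ 0) : Y *ᵥ v ≠ 0 := by
  intro h0
  have := congrArg (fun w => V2.toRows₂ *ᵥ w) h0
  simp only [mulVec_mulVec, h.V22_Y, mulVec_zero, neg_mulVec, one_mulVec, neg_eq_zero] at this
  exact hv this

/-- Only the zero vector is orthogonal to `N` and `V1` and killed by `S`. Stating this as
definiteness of a sum of Gram forms turns the spanning condition of the certificate into one stable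
under perturbation. -/
theorem kernel_form_pos (v : ι ⊕ τ → ℝ) (hv : v ≠ 0) :
    0 < v ⬝ᵥ ((aug (baseSol V2 Y) * (aug (baseSol V2 Y))ᵀ + V1 * V1ᵀ +
      D.toRows₁ᵀ * D.toRows₁) *ᵥ v) := by
  have e1 := gram_form_nonneg (aug (baseSol V2 Y))ᵀ v
  have e2 := gram_form_nonneg V1ᵀ v
  have e3 := gram_form_nonneg D.toRows₁ v
  rw [transpose_transpose] at e1 e2
  rw [add_mulVec, add_mulVec, dotProduct_add, dotProduct_add]
  refine lt_of_le_of_ne (by positivity) fun h0 => hv ?_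
  have z1 := mulVec_eq_zero_of_gram_form (A := (aug (baseSol V2 Y))ᵀ) (v := v)
    (by rw [transpose_transpose]; linarith)
  have z2 := mulVec_eq_zero_of_gram_form (A := V1ᵀ) (v := v)
    (by rw [transpose_transpose]; linarith)
  have z3 := mulVec_eq_zero_of_gram_form (A := D.toRows₁) (v := v) (by linarith)
  have z4 : V2ᵀ *ᵥ v = 0 := by
    have h1 : -V2.toRows₂ᵀ * Yᵀ = 1 := by
      refine mul_eq_one_comm.1 ?_
      rw [Matrix.mul_neg, ← transpose_mul, h.V22_Y, transpose_neg, neg_neg, transpose_one]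
    rw [h.aug_baseSol, transpose_mul] at z1
    rw [← one_mulVec (V2ᵀ *ᵥ v), ← h1, ← mulVec_mulVec, mulVec_mulVec v, z1, mulVec_zero]
  have z5 : Vsᵀ *ᵥ v = 0 := by
    have h1 := h.solve_diagonal (x := Vsᵀ) (y := -D.toRows₁) (by rw [← h.S_eq, add_neg_cancel])
    rw [h1, Matrix.mul_neg, neg_neg, ← mulVec_mulVec, z3, mulVec_zero]
  rw [← one_mulVec v, ← h.complete, add_mulVec, add_mulVec, ← mulVec_mulVec, ← mulVec_mulVec,
    ← mulVec_mulVec, z2, z4, z5]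
  simp

theorem V1_form_pos {lam : ℝ} (hlam : ∀ i, lam < σ1 i ^ 2) (v : β → ℝ) (hv : v ≠ 0) :
    0 < v ⬝ᵥ ((V1ᵀ * (D.toRows₂ᵀ * D.toRows₂ - lam • 1) * V1) *ᵥ v) := by
  have x : V1ᵀ * (D.toRows₂ᵀ * D.toRows₂ - lam • 1) * V1 =
      (D.toRows₂ * V1)ᵀ * (D.toRows₂ * V1) - lam • (V1ᵀ * V1) := by
    simp only [Matrix.mul_sub, Matrix.sub_mul, transpose_mul, Matrix.mul_assoc,
      Matrix.mul_smul, Matrix.smul_mul, Matrix.one_mul]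
  have y : V1ᵀ * (D.toRows₂ᵀ * D.toRows₂ - lam • 1) * V1 =
      diagonal fun i => σ1 i * σ1 i - lam := by
    rw [x, h.P_V1, transpose_mul, Matrix.mul_assoc, ← Matrix.mul_assoc U1ᵀ, h.U1_U1, h.V1_V1,
      Matrix.one_mul, diagonal_transpose, diagonal_mul_diagonal, smul_one_eq_diagonal,
      diagonal_sub]
  rw [y]
  exact diagonal_form_pos (fun i => sub_pos.2 (by rw [← sq]; exact hlam i)) v hv

theorem aug_form_pos {lam : ℝ} (hlam : ∀ j, σ2 j ^ 2 < lam) (v : τ → ℝ) (hv : v ≠ 0) :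
    0 < v ⬝ᵥ (((aug (baseSol V2 Y))ᵀ * (lam • 1 - D.toRows₂ᵀ * D.toRows₂) *
      aug (baseSol V2 Y)) *ᵥ v) := by
  have x : (V2 * Y)ᵀ * (lam • 1 - D.toRows₂ᵀ * D.toRows₂) * (V2 * Y) =
      Yᵀ * (lam • (V2ᵀ * V2) - (D.toRows₂ * V2)ᵀ * (D.toRows₂ * V2)) * Y := by
    simp only [Matrix.mul_sub, Matrix.sub_mul, transpose_mul, Matrix.mul_assoc,
      Matrix.mul_smul, Matrix.smul_mul, Matrix.one_mul]
  have y : (V2 * Y)ᵀ * (lam • 1 - D.toRows₂ᵀ * D.toRows₂) * (V2 * Y) =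
      Yᵀ * (diagonal fun j => lam - σ2 j * σ2 j) * Y := by
    rw [x, h.P_V2, transpose_mul U2, Matrix.mul_assoc _ U2ᵀ, ← Matrix.mul_assoc U2ᵀ, h.U2_U2,
      h.V2_V2, Matrix.one_mul, diagonal_transpose, diagonal_mul_diagonal,
      smul_one_eq_diagonal, diagonal_sub]
  rw [h.aug_baseSol, y, dotProduct_conj_mulVec]
  exact diagonal_form_pos (fun j => sub_pos.2 (by rw [← sq]; exact hlam j)) _
    (h.Y_mulVec_ne_zero hv)

/-- Separation of finite sets is used because either index type may be empty, for instance `β` when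
`n = 4p`. -/
theorem exists_between_sq : ∃ lam, (∀ j, σ2 j ^ 2 < lam) ∧ ∀ i, lam < σ1 i ^ 2 := by
  obtain ⟨lam, x1, x2⟩ := Order.exists_between_finsets
    (Finset.univ.image fun j => σ2 j ^ 2) (Finset.univ.image fun i => σ1 i ^ 2) (by
      simp only [Finset.mem_image, Finset.mem_univ, true_and]
      rintro _ ⟨j, rfl⟩ _ ⟨i, rfl⟩
      exact h.sq_gap i j)
  exact ⟨lam, fun j => x1 _ (Finset.mem_image_of_mem _ (Finset.mem_univ j)),
    fun i => x2 _ (Finset.mem_image_of_mem _ (Finset.mem_univ i))⟩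

/-- Certificates of optimality depending continuously on the data exist near the data. -/
theorem eventually_isTLSESol_iff {x : Matrix (ν ⊕ μ) (ι ⊕ τ) ℝ → Matrix ι τ ℝ}
    {k : Matrix (ν ⊕ μ) (ι ⊕ τ) ℝ → Matrix (ι ⊕ τ) β ℝ} (hx : ContinuousAt x D)
    (hk : ContinuousAt k D) (hx0 : x D = baseSol V2 Y) (hk0 : k D = V1)
    (hz : ∀ᶠ D' in 𝓝 D, D'.toRows₁ * aug (x D') = 0 ∧ D'.toRows₁ * k D' = 0 ∧
      (aug (x D'))ᵀ * k D' = 0 ∧ (D'.toRows₂ * k D')ᵀ * (D'.toRows₂ * aug (x D')) = 0) :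
    ∀ᶠ D' in 𝓝 D, ∀ X, IsTLSESol D' X ↔ X = x D' := by
  obtain ⟨lam, hlam2, hlam1⟩ := h.exists_between_sq
  have hs : ContinuousAt (fun D' : Matrix (ν ⊕ μ) (ι ⊕ τ) ℝ => D'.toRows₁) D :=
    (toRows₁CLM ν μ (ι ⊕ τ)).continuous.continuousAt
  have hp : ContinuousAt (fun D' : Matrix (ν ⊕ μ) (ι ⊕ τ) ℝ => D'.toRows₂) D :=
    (toRows₂CLM ν μ (ι ⊕ τ)).continuous.continuousAt
  have hn := continuousAt_aug hx
  have hm := continuousAt_matrix_mul (continuousAt_matrix_transpose hp) hp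
  -- With `lam` fixed once and for all, each inequality in the certificate is positivity of a form
  -- continuous in the data.
  have c1 := eventually_form_pos
    (continuousAt_matrix_mul (continuousAt_matrix_mul (continuousAt_matrix_transpose hk)
      (hm.sub (continuousAt_const (y := lam • 1)))) hk)
    (by rw [hk0]; exact h.V1_form_pos hlam1)
  have c2 := eventually_form_pos
    (continuousAt_matrix_mul (continuousAt_matrix_mul (continuousAt_matrix_transpose hn)
      ((continuousAt_const (y := lam • 1)).sub hm)) hn)
    (by rw [hx0]; exact h.aug_form_pos hlam2)
  have c3 := eventually_form_pos
    (Q := fun D' => aug (x D') * (aug (x D'))ᵀ + k D' * (k D')ᵀ + D'.toRows₁ᵀ * D'.toRows₁)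
    (((continuousAt_matrix_mul hn (continuousAt_matrix_transpose hn)).add
      (continuousAt_matrix_mul hk (continuousAt_matrix_transpose hk))).add
      (continuousAt_matrix_mul (continuousAt_matrix_transpose hs) hs))
    (by rw [hx0, hk0]; exact h.kernel_form_pos)
  filter_upwards [hz, c1, c2, c3] with D' hz p1 p2 p3 X
  refine isTLSESol_iff_eq D' _ (k D') lam hz.1 hz.2.1 hz.2.2.1 hz.2.2.2 ?_ p1 p2 X
  intro R r1 r2 r3
  ext i j
  by_contra hij
  have hR : R.col j ≠ 0 := fun hc => hij (congrFun hc i)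
  have z1 : (aug (x D'))ᵀ *ᵥ R.col j = 0 := funext fun i => congrFun (congrFun r1 i) j
  have z2 : (k D')ᵀ *ᵥ R.col j = 0 := funext fun i => congrFun (congrFun r2 i) j
  have z3 : D'.toRows₁ *ᵥ R.col j = 0 := funext fun i => congrFun (congrFun r3 i) j
  have := p3 _ hR
  rw [add_mulVec, add_mulVec, ← mulVec_mulVec, ← mulVec_mulVec, ← mulVec_mulVec, z1, z2, z3,
    mulVec_zero, mulVec_zero, mulVec_zero] at this
  simp at this

/-- Near the data the problem has exactly one solution, which depends differentiably on the data,
with derivative given by the solution of the linearized system. -/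
theorem exists_solution_map :
    ∃ (φ : Matrix (ν ⊕ μ) (ι ⊕ τ) ℝ → Matrix ι τ ℝ)
      (L : Matrix (ν ⊕ μ) (ι ⊕ τ) ℝ →L[ℝ] Matrix ι τ ℝ),
      HasFDerivAt φ L D ∧ φ D = baseSol V2 Y ∧
      (∀ᶠ D' in 𝓝 D, ∀ X, IsTLSESol D' X ↔ X = φ D') ∧
      ∀ Δ, ∃ (a : Matrix ν τ ℝ) (b : Matrix β τ ℝ),
        L Δ = fromCols (1 : Matrix ι ι ℝ) (baseSol V2 Y) * (Vs * a + V1 * b) * Y ∧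
        a = -(diagonal s⁻¹ * Usᵀ * (Δ.toRows₁ * V2)) ∧
        diagonal σ1 * diagonal σ1 * b - b * diagonal σ2 * diagonal σ2 =
          -(diagonal σ1 * U1ᵀ *
              ((Δ.toRows₂ - D.toRows₂ * (Vs * diagonal s⁻¹ * Usᵀ) * Δ.toRows₁) * V2) +
            ((Δ.toRows₂ - D.toRows₂ * (Vs * diagonal s⁻¹ * Usᵀ) * Δ.toRows₁) * V1)ᵀ *
              U2 * diagonal σ2) := by
  obtain ⟨F', hF, hF'⟩ := hasStrictFDerivAt_system D Vs V1 V2 Y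
  have hd0 : displacement Vs V1 V2 Y 0 = 0 := by simp [displacement]
  have hk0 : kerBasis Vs V1 V2 (0 : Unknown ν τ β) = V1 := by simp [kerBasis]
  have hN0 := h.aug_baseSol
  have h0 : system Vs V1 V2 Y (D, 0) = 0 := by
    have x1 : D.toRows₁ * (V2 * Y) = 0 := by rw [← Matrix.mul_assoc, h.S_V2, Matrix.zero_mul]
    have x2 : (D.toRows₂ * V1)ᵀ * (D.toRows₂ * (V2 * Y)) = 0 := by
      rw [← Matrix.mul_assoc D.toRows₂, h.P_V1, h.P_V2, transpose_mul, Matrix.mul_assoc,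
        Matrix.mul_assoc U2, ← Matrix.mul_assoc U1ᵀ, h.U1_U2]
      simp
    have x3 : (V2 * Y)ᵀ * V1 = 0 := by
      rw [transpose_mul, Matrix.mul_assoc, h.V2_V1, Matrix.mul_zero]
    simp only [system, hd0, hk0, add_zero, hN0, x1, x2, x3, h.S_V1]
    rfl
  have hlin : ∀ Δ u, F' (Δ, u) = 0 → _ := fun Δ u hz => by
    rw [hF'] at hz
    simp only [Prod.ext_iff] at hz
    exact h.linearized (Δ := Δ) (u := u) rfl hz.1 hz.2.1 hz.2.2.1 hz.2.2.2
  -- Without a perturbation the formulas give `a = 0` and `f = 0`; the Sylvester equation becomes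
  -- homogeneous, hence `b = 0` and then `e = 0`.
  have hinj : ∀ u, F' (0, u) = 0 → u = 0 := by
    intro u hu
    obtain ⟨ha, hf, he, hb⟩ := hlin 0 u hu
    have z1 : (0 : Matrix (ν ⊕ μ) (ι ⊕ τ) ℝ).toRows₁ = 0 := rfl
    have z2 : (0 : Matrix (ν ⊕ μ) (ι ⊕ τ) ℝ).toRows₂ = 0 := rfl
    simp only [z1, z2, Matrix.zero_mul, Matrix.mul_zero, neg_zero, sub_zero, transpose_zero,
      add_zero] at ha hf hb
    have hb' := h.sylvester_injective hb
    rw [hb', transpose_zero, neg_zero] at he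
    exact Prod.ext ha (Prod.ext hb' (Prod.ext he hf))
  obtain ⟨ψ, ψ', hψ, hψ0, hev, hψ'⟩ := exists_implicit_function hF h0 hinj
  let dL : Unknown ν τ β →ₗ[ℝ] Matrix ι τ ℝ :=
    { toFun := displacement Vs V1 V2 Y
      map_add' := displacement_add Vs V1 V2 Y
      map_smul' := displacement_smul Vs V1 V2 Y }
  refine ⟨fun D' => baseSol V2 Y + displacement Vs V1 V2 Y (ψ D'), dL.toContinuousLinearMap ∘L ψ',
    ?_, ?_, ?_, fun Δ => ?_⟩
  · exact (dL.toContinuousLinearMap.hasFDerivAt.comp D hψ.hasFDerivAt).const_add _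
  · simp only [hψ0, hd0, add_zero]
  · refine h.eventually_isTLSESol_iff (k := fun D' => kerBasis Vs V1 V2 (ψ D'))
      (continuousAt_const.add
        (dL.toContinuousLinearMap.continuous.continuousAt.comp hψ.hasFDerivAt.continuousAt)) ?_
      (by simp only [hψ0, hd0, add_zero]) (by simp only [hψ0, hk0]) ?_
    · have hc := hψ.hasFDerivAt.continuousAt
      exact continuousAt_const.add
        ((continuousAt_matrix_mul continuousAt_const hc.snd.snd.fst).add
          (continuousAt_matrix_mul continuousAt_const hc.snd.snd.snd))
    · filter_upwards [hev] with D' hz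
      simp only [system, Prod.ext_iff] at hz
      exact ⟨hz.1, hz.2.2.2, hz.2.2.1, hz.2.1⟩
  · obtain ⟨ha, -, -, hb⟩ := hlin Δ (ψ' Δ) (hψ' Δ)
    exact ⟨_, _, rfl, ha, hb⟩

end AdaptedBasis

end Perturbation

end RBTLSE

/-! ### Condition numbers and operator norms. -/

namespace RBTLSE

/-- The normwise condition number of a differentiable map is the norm of its derivative, up to
the scaling factors `M` of the data and `c` of the value. -/
theorem exists_tendsto_sup_errors {E G : Type*} [NormedAddCommGroup E] [NormedSpace ℝ E]
    [NormedAddCommGroup G] [NormedSpace ℝ G] {φ : E → G} {L : E →L[ℝ] G} {x₀ : E}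
    (hφ : HasFDerivAt φ L x₀) {M c : ℝ} (hM : 0 < M) (hc : 0 < c) :
    ∃ s : ℝ → ℝ, (∀ᶠ ε in 𝓝[>] (0 : ℝ),
      IsLUB {r | ∃ Δ : E, ‖Δ‖ ≤ ε * M ∧ r = ‖φ x₀ - φ (x₀ + Δ)‖ / (ε * c)} (s ε)) ∧
      Tendsto s (𝓝[>] (0 : ℝ)) (𝓝 (‖L‖ * M / c)) := by
  set T : ℝ → Set ℝ := fun ε => {r | ∃ Δ : E, ‖Δ‖ ≤ ε * M ∧ r = ‖φ x₀ - φ (x₀ + Δ)‖ / (ε * c)}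
    with hT
  have approx : ∀ η > 0, ∀ᶠ ε in 𝓝[>] (0 : ℝ), 0 < ε ∧ ∀ Δ : E, ‖Δ‖ ≤ ε * M →
      |‖φ x₀ - φ (x₀ + Δ)‖ - ‖L Δ‖| ≤ η * ‖Δ‖ := by
    intro η hη
    have h1 := (hasFDerivAt_iff_isLittleO_nhds_zero.1 hφ).def hη
    obtain ⟨δ, hδ, h2⟩ := Metric.eventually_nhds_iff.1 h1
    have h3 : ∀ᶠ ε in 𝓝[>] (0 : ℝ), ε * M < δ := by
      have : Tendsto (fun ε : ℝ => ε * M) (𝓝[>] 0) (𝓝 0) := by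
        have : Tendsto (fun ε : ℝ => ε * M) (𝓝 0) (𝓝 (0 * M)) := tendsto_id.mul_const M
        rw [zero_mul] at this
        exact this.mono_left nhdsWithin_le_nhds
      exact this.eventually (gt_mem_nhds hδ)
    filter_upwards [h3, self_mem_nhdsWithin] with ε hε hε0
    refine ⟨hε0, fun Δ hΔ => ?_⟩
    have h4 := h2 (y := Δ) (by rw [dist_zero_right]; exact hΔ.trans_lt hε)
    refine le_trans ?_ h4
    rw [norm_sub_rev]
    exact abs_norm_sub_norm_le _ _
  have upper : ∀ η > 0, ∀ᶠ ε in 𝓝[>] (0 : ℝ), ∀ r ∈ T ε, r ≤ (‖L‖ + η) * M / c := by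
    intro η hη
    filter_upwards [approx η hη] with ε ⟨hε, h⟩
    rintro r ⟨Δ, hΔ, rfl⟩
    have h1 := (abs_le.1 (h Δ hΔ)).2
    have h2 := L.le_opNorm Δ
    rw [div_le_div_iff₀ (by positivity) hc]
    have h3 : ‖φ x₀ - φ (x₀ + Δ)‖ ≤ (‖L‖ + η) * (ε * M) :=
      calc _ ≤ (‖L‖ + η) * ‖Δ‖ := by linarith
        _ ≤ _ := by gcongr
    calc _ ≤ (‖L‖ + η) * (ε * M) * c := by gcongr
      _ = _ := by ring
  have nonempty : ∀ ε > 0, (T ε).Nonempty := fun ε hε =>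
    ⟨_, 0, by rw [norm_zero]; positivity, rfl⟩
  refine ⟨fun ε => sSup (T ε), ?_, ?_⟩
  · filter_upwards [upper 1 one_pos, self_mem_nhdsWithin] with ε h hε
    exact isLUB_csSup (nonempty ε hε) ⟨_, h⟩
  · rw [Metric.tendsto_nhds]
    intro e he
    -- Chosen so that `η * M / c = e / 4`. The supremum exceeds the limit by at most one such error.
    -- It falls short by at most two, one from linearization and one from a nearly norming vector
    -- `x`.
    have hη : 0 < e * c / (4 * M) := by positivity
    set η := e * c / (4 * M) with hη'
    have hηe : η * M / c = e / 4 := by rw [hη']; field_simp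
    obtain ⟨x, hx1, hx⟩ := L.exists_lt_apply_of_lt_opNorm (sub_lt_self ‖L‖ hη)
    filter_upwards [upper η hη, approx η hη] with ε hup ⟨hε, happ⟩
    have h1 : sSup (T ε) ≤ (‖L‖ + η) * M / c := csSup_le (nonempty ε hε) hup
    have hn : ‖(ε * M) • x‖ ≤ ε * M := by
      rw [norm_smul, Real.norm_of_nonneg (by positivity)]
      exact mul_le_of_le_one_right (by positivity) hx1.le
    have h2 : (‖L‖ - 2 * η) * M / c ≤ sSup (T ε) := by
      refine le_trans ?_ (le_csSup ⟨_, hup⟩ ⟨(ε * M) • x, hn, rfl⟩)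
      have h3 := (abs_le.1 (happ _ hn)).1
      rw [map_smul, norm_smul _ (L x), Real.norm_of_nonneg (by positivity)] at h3
      rw [div_le_div_iff₀ hc (by positivity)]
      have h4 : (ε * M) * (‖L‖ - η) ≤ ε * M * ‖L x‖ := by gcongr
      have h5 : η * ‖(ε * M) • x‖ ≤ η * (ε * M) := by gcongr
      calc _ = ((ε * M) * (‖L‖ - η) - η * (ε * M)) * c := by ring
        _ ≤ _ := by gcongr; linarith
    have h3 : (‖L‖ + η) * M / c = ‖L‖ * M / c + e / 4 := by rw [← hηe]; ring
    have h4 : (‖L‖ - 2 * η) * M / c = ‖L‖ * M / c - 2 * (e / 4) := by rw [← hηe]; ring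
    rw [Real.dist_eq, abs_lt]
    constructor <;> linarith

theorem norm_toLp_eq {m : Type*} [Fintype m] (v : m → ℝ) :
    ‖(WithLp.toLp 2 v : EuclideanSpace ℝ m)‖ = Real.sqrt (∑ i, v i ^ 2) := by
  simp [EuclideanSpace.norm_eq]

theorem norm_toLp_vec {m n : Type*} [Fintype m] [Fintype n] (A : Matrix m n ℝ) :
    ‖(WithLp.toLp 2 A.vec : EuclideanSpace ℝ (n × m))‖ = frob A := by
  rw [norm_toLp_eq, frob_eq_sqrt, Fintype.sum_prod_type, Finset.sum_comm]
  rfl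

theorem norm_toLp_sumElim_sq {m n : Type*} [Fintype m] [Fintype n] (v : m → ℝ) (w : n → ℝ) :
    ‖(WithLp.toLp 2 (Sum.elim v w) : EuclideanSpace ℝ (m ⊕ n))‖ ^ 2 =
      ‖(WithLp.toLp 2 v : EuclideanSpace ℝ m)‖ ^ 2 +
      ‖(WithLp.toLp 2 w : EuclideanSpace ℝ n)‖ ^ 2 := by
  rw [norm_toLp_eq, norm_toLp_eq, norm_toLp_eq, Real.sq_sqrt (by positivity),
    Real.sq_sqrt (by positivity), Real.sq_sqrt (by positivity), Fintype.sum_sum_type]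
  rfl

open scoped Matrix.Norms.L2Operator in
theorem specNorm_nonneg {m n : Type*} [Fintype m] [Fintype n] [DecidableEq n]
    (A : Matrix m n ℝ) : 0 ≤ specNorm A :=
  norm_nonneg A

open scoped Matrix.Norms.L2Operator in
theorem norm_mulVec_le_specNorm {m n : Type*} [Fintype m] [Fintype n] [DecidableEq n]
    (A : Matrix m n ℝ) (v : n → ℝ) :
    ‖(WithLp.toLp 2 (A *ᵥ v) : EuclideanSpace ℝ m)‖ ≤
      specNorm A * ‖(WithLp.toLp 2 v : EuclideanSpace ℝ n)‖ :=
  A.l2_opNorm_mulVec (WithLp.toLp 2 v)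

theorem specNorm_le {m n : Type*} [Fintype m] [Fintype n] [DecidableEq n] (A : Matrix m n ℝ)
    {c : ℝ} (hc : 0 ≤ c) (h : ∀ v : n → ℝ, ‖(WithLp.toLp 2 (A *ᵥ v) : EuclideanSpace ℝ m)‖ ≤
      c * ‖(WithLp.toLp 2 v : EuclideanSpace ℝ n)‖) : specNorm A ≤ c := by
  rw [specNorm, l2_opNorm_def]
  exact ContinuousLinearMap.opNorm_le_bound _ hc fun v => h v.ofLp

/-- If a linear map factors through a coisometry `z` and a matrix `A`, up to an isometry, its norm
is the spectral norm of `A`. -/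
theorem opNorm_eq_specNorm {E G r c : Type*} [NormedAddCommGroup E] [NormedSpace ℝ E]
    [NormedAddCommGroup G] [NormedSpace ℝ G] [Fintype r] [Fintype c] [DecidableEq c]
    (L : E →L[ℝ] G) (A : Matrix r c ℝ) (z : E → c → ℝ)
    (hL : ∀ Δ, ‖L Δ‖ = ‖(WithLp.toLp 2 (A *ᵥ z Δ) : EuclideanSpace ℝ r)‖)
    (hz : ∀ Δ, ‖(WithLp.toLp 2 (z Δ) : EuclideanSpace ℝ c)‖ ≤ ‖Δ‖)
    (hz' : ∀ w, ∃ Δ, z Δ = w ∧ ‖Δ‖ = ‖(WithLp.toLp 2 w : EuclideanSpace ℝ c)‖) :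
    ‖L‖ = specNorm A := by
  have hA := specNorm_nonneg A
  refine le_antisymm (L.opNorm_le_bound hA fun Δ => ?_) (specNorm_le A (norm_nonneg L) fun w => ?_)
  · rw [hL]
    exact (norm_mulVec_le_specNorm A _).trans (mul_le_mul_of_nonneg_left (hz Δ) hA)
  · obtain ⟨Δ, rfl, hΔ⟩ := hz' w
    rw [← hL, ← hΔ]
    exact L.le_opNorm Δ

end RBTLSE

namespace RBTLSE

/-! ### Coordinates of the perturbation as a coisometry. -/

section Coisometry

variable {ρ κ ι τ : Type*} [Fintype ρ] [Fintype κ] [Fintype ι] [Fintype τ]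

/-- The coordinates of a data perturbation on which the first-order change of the solution
depends. -/
def coords (W : Matrix κ ι ℝ) (V : Matrix κ τ ℝ) (T : Matrix ρ ι ℝ) (Δ : Matrix ρ κ ℝ) :
    (ι × ρ) ⊕ (ι × τ) → ℝ :=
  Sum.elim (Δ * W).vec (Tᵀ * (Δ * V))ᵀ.vec

theorem frob_transpose (M : Matrix ρ κ ℝ) : frob Mᵀ = frob M := by
  rw [frob_eq_sqrt, frob_eq_sqrt, Finset.sum_comm]
  rfl

theorem norm_coords_sq (W : Matrix κ ι ℝ) (V : Matrix κ τ ℝ) (T : Matrix ρ ι ℝ)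
    (Δ : Matrix ρ κ ℝ) :
    ‖(WithLp.toLp 2 (coords W V T Δ) : EuclideanSpace ℝ _)‖ ^ 2 =
      frob (Δ * W) ^ 2 + frob (Tᵀ * (Δ * V)) ^ 2 := by
  rw [coords, norm_toLp_sumElim_sq, norm_toLp_vec, norm_toLp_vec, frob_transpose]

theorem frob_mul_sq (Δ : Matrix ρ κ ℝ) (V : Matrix κ τ ℝ) :
    frob (Δ * V) ^ 2 = (Δᵀ * Δ * (V * Vᵀ)).trace := by
  rw [frob_sq, transpose_mul, Matrix.mul_assoc, trace_mul_comm]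
  simp only [Matrix.mul_assoc]

theorem frob_sq_split [DecidableEq κ] {W : Matrix κ ι ℝ} {V : Matrix κ τ ℝ}
    (h : W * Wᵀ + V * Vᵀ = 1) (Δ : Matrix ρ κ ℝ) :
    frob Δ ^ 2 = frob (Δ * W) ^ 2 + frob (Δ * V) ^ 2 := by
  rw [frob_mul_sq, frob_mul_sq, ← trace_add, ← Matrix.mul_add, h, Matrix.mul_one, frob_sq]

variable [DecidableEq ι]

theorem frob_isometry_mul {T : Matrix ρ ι ℝ} (hT : Tᵀ * T = 1) (M : Matrix ι τ ℝ) :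
    frob (T * M) ^ 2 = frob M ^ 2 := by
  rw [frob_sq, frob_sq, transpose_mul, Matrix.mul_assoc, ← Matrix.mul_assoc Tᵀ, hT,
    Matrix.one_mul]

/-- Pythagoras: the difference of the squares is the squared norm of `M - T * (Tᵀ * M)`. -/
theorem frob_transpose_isometry_mul_le {T : Matrix ρ ι ℝ} (hT : Tᵀ * T = 1)
    (M : Matrix ρ τ ℝ) : frob (Tᵀ * M) ^ 2 ≤ frob M ^ 2 := by
  have h : frob (M - T * (Tᵀ * M)) ^ 2 = frob M ^ 2 - frob (Tᵀ * M) ^ 2 := by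
    have h1 : (M - T * (Tᵀ * M))ᵀ * (M - T * (Tᵀ * M)) = Mᵀ * M - (Tᵀ * M)ᵀ * (Tᵀ * M) := by
      have : Tᵀ * (T * (Tᵀ * M)) = Tᵀ * M := by rw [← Matrix.mul_assoc, hT, Matrix.one_mul]
      simp only [transpose_sub, transpose_mul, transpose_transpose, Matrix.sub_mul, Matrix.mul_sub,
        Matrix.mul_assoc, this]
      abel
    rw [frob_sq, frob_sq, frob_sq, h1, trace_sub]
  have := sq_nonneg (frob (M - T * (Tᵀ * M)))
  linarith

theorem norm_coords_le [DecidableEq κ] {W : Matrix κ ι ℝ} {V : Matrix κ τ ℝ}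
    {T : Matrix ρ ι ℝ} (h : W * Wᵀ + V * Vᵀ = 1) (hT : Tᵀ * T = 1) (Δ : Matrix ρ κ ℝ) :
    ‖(WithLp.toLp 2 (coords W V T Δ) : EuclideanSpace ℝ _)‖ ≤ frob Δ := by
  rw [← sq_le_sq₀ (norm_nonneg _) (frob_nonneg _), norm_coords_sq, frob_sq_split h]
  have := frob_transpose_isometry_mul_le hT (Δ * V)
  linarith

theorem exists_coords_eq [DecidableEq κ] [DecidableEq τ] {W : Matrix κ ι ℝ} {V : Matrix κ τ ℝ}
    {T : Matrix ρ ι ℝ} (h : W * Wᵀ + V * Vᵀ = 1) (hT : Tᵀ * T = 1) (hW : Wᵀ * W = 1)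
    (hWV : Wᵀ * V = 0) (hV : Vᵀ * V = 1) (w : (ι × ρ) ⊕ (ι × τ) → ℝ) :
    ∃ Δ, coords W V T Δ = w ∧ frob Δ = ‖(WithLp.toLp 2 w : EuclideanSpace ℝ _)‖ := by
  obtain ⟨X, hX⟩ := (vec_bijective (R := ℝ)).2 (w ∘ Sum.inl)
  obtain ⟨Z, hZ⟩ := (vec_bijective (R := ℝ)).2 (w ∘ Sum.inr)
  have hVW : Vᵀ * W = 0 := by simpa using congrArg transpose hWV
  have h1 : (X * Wᵀ + T * Zᵀ * Vᵀ) * W = X := by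
    rw [Matrix.add_mul, Matrix.mul_assoc, hW, Matrix.mul_assoc _ Vᵀ, hVW]
    simp
  have h2 : (X * Wᵀ + T * Zᵀ * Vᵀ) * V = T * Zᵀ := by
    rw [Matrix.add_mul, Matrix.mul_assoc, hWV, Matrix.mul_assoc _ Vᵀ, hV]
    simp
  have h3 : Tᵀ * (T * Zᵀ) = Zᵀ := by rw [← Matrix.mul_assoc, hT, Matrix.one_mul]
  -- The preimage of least norm: the adjoint of the coordinate map, applied to the reshaped halves
  -- `X` and `Z` of `w`.
  have hc : coords W V T (X * Wᵀ + T * Zᵀ * Vᵀ) = w := by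
    rw [coords, h1, h2, h3, transpose_transpose, hX, hZ, Sum.elim_comp_inl_inr]
  refine ⟨_, hc, ?_⟩
  rw [← sq_eq_sq₀ (frob_nonneg _) (norm_nonneg _), ← hc, norm_coords_sq, frob_sq_split h, h2, h3,
    frob_isometry_mul hT]

end Coisometry

/-! ### Calculus of stacked blocks of sizes `a + b = n`. -/

section Blocks

variable {a b n d : ℕ} (hn : n = a + b)

/-- Blocks of `a` and `b` rows put on top of each other, where `n = a + b`. -/
def stack {κ : Type*} (X : Matrix (Fin a) κ ℝ) (Z : Matrix (Fin b) κ ℝ) : Matrix (Fin n) κ ℝ :=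
  (fromRows X Z).submatrix (blockEquiv hn).symm id

theorem block_mul_stack {κ : Type*} [Fintype κ] (M₁₁ : Matrix (Fin a) (Fin a) ℝ)
    (M₁₂ : Matrix (Fin a) (Fin b) ℝ) (M₂₁ : Matrix (Fin b) (Fin a) ℝ)
    (M₂₂ : Matrix (Fin b) (Fin b) ℝ) (X : Matrix (Fin a) κ ℝ) (Z : Matrix (Fin b) κ ℝ) :
    block hn M₁₁ M₁₂ M₂₁ M₂₂ * stack hn X Z =
      stack hn (M₁₁ * X + M₁₂ * Z) (M₂₁ * X + M₂₂ * Z) := by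
  rw [block, stack, reindex_apply, submatrix_mul_equiv, fromBlocks_mul_fromRows, stack]

theorem stack_mul {κ κ' : Type*} [Fintype κ] (X : Matrix (Fin a) κ ℝ) (Z : Matrix (Fin b) κ ℝ)
    (M : Matrix κ κ' ℝ) : stack hn X Z * M = stack hn (X * M) (Z * M) := by
  rw [stack, stack, ← fromRows_mul]
  rfl

theorem stack_add {κ : Type*} (X X' : Matrix (Fin a) κ ℝ) (Z Z' : Matrix (Fin b) κ ℝ) :
    stack hn X Z + stack hn X' Z' = stack hn (X + X') (Z + Z') := by
  ext i j
  obtain ⟨i | i, rfl⟩ := (blockEquiv hn).surjective i <;> simp [stack]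

theorem stack_neg {κ : Type*} (X : Matrix (Fin a) κ ℝ) (Z : Matrix (Fin b) κ ℝ) :
    -stack hn X Z = stack hn (-X) (-Z) := by
  ext i j
  obtain ⟨i | i, rfl⟩ := (blockEquiv hn).surjective i <;> simp [stack]

theorem block_diagonal (x : Fin a → ℝ) (y : Fin b → ℝ) :
    block hn (diagonal x) 0 0 (diagonal y) =
      diagonal (Sum.elim x y ∘ (blockEquiv hn).symm) := by
  rw [block, reindex_apply, fromBlocks_diagonal, submatrix_diagonal_equiv]

/-- The blocks `[V_s, V₁]` as one matrix with `n = a + b` columns. -/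
def joinCols {κ : Type*} (Vs : Matrix κ (Fin a) ℝ) (V1 : Matrix κ (Fin b) ℝ) :
    Matrix κ (Fin n) ℝ :=
  (stack hn Vsᵀ V1ᵀ)ᵀ

theorem joinCols_mul_stack {κ κ' : Type*} (Vs : Matrix κ (Fin a) ℝ)
    (V1 : Matrix κ (Fin b) ℝ) (X : Matrix (Fin a) κ' ℝ) (Z : Matrix (Fin b) κ' ℝ) :
    joinCols hn Vs V1 * stack hn X Z = Vs * X + V1 * Z := by
  rw [joinCols, stack, stack, transpose_submatrix, submatrix_mul_equiv, transpose_fromRows,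
    fromCols_mul_fromRows]
  rfl

theorem joinCols_transpose_mul {κ κ' : Type*} [Fintype κ] (Vs : Matrix κ (Fin a) ℝ)
    (V1 : Matrix κ (Fin b) ℝ) (M : Matrix κ κ' ℝ) :
    (joinCols hn Vs V1)ᵀ * M = stack hn (Vsᵀ * M) (V1ᵀ * M) := by
  rw [joinCols, transpose_transpose, stack_mul]

theorem mul_joinCols {κ κ' : Type*} [Fintype κ] (M : Matrix κ' κ ℝ) (Vs : Matrix κ (Fin a) ℝ)
    (V1 : Matrix κ (Fin b) ℝ) : M * joinCols hn Vs V1 = joinCols hn (M * Vs) (M * V1) := by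
  rw [joinCols, joinCols, transpose_mul, transpose_mul, ← stack_mul, transpose_mul,
    transpose_transpose]

theorem joinCols_orthonormal {κ : Type*} [Fintype κ] {Vs : Matrix κ (Fin a) ℝ}
    {V1 : Matrix κ (Fin b) ℝ} (h1 : Vsᵀ * Vs = 1) (h2 : Vsᵀ * V1 = 0) (h3 : V1ᵀ * V1 = 1) :
    (joinCols hn Vs V1)ᵀ * joinCols hn Vs V1 = 1 := by
  have h4 : V1ᵀ * Vs = 0 := by simpa using congrArg transpose h2
  rw [joinCols_transpose_mul, mul_joinCols, mul_joinCols, h1, h2, h3, h4]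
  ext i j
  obtain ⟨i | i, rfl⟩ := (blockEquiv hn).surjective i <;>
  obtain ⟨j | j, rfl⟩ := (blockEquiv hn).surjective j <;>
  simp [stack, joinCols, one_apply, eq_comm]

theorem joinCols_mul_transpose {κ : Type*} (Vs : Matrix κ (Fin a) ℝ) (V1 : Matrix κ (Fin b) ℝ) :
    joinCols hn Vs V1 * (joinCols hn Vs V1)ᵀ = Vs * Vsᵀ + V1 * V1ᵀ := by
  rw [← joinCols_mul_stack hn, joinCols, transpose_transpose]

theorem W1_eq_toRows₁ (Vs : Matrix (Fin n ⊕ Fin d) (Fin a) ℝ)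
    (V1 : Matrix (Fin n ⊕ Fin d) (Fin b) ℝ) : W1 hn Vs V1 = (joinCols hn Vs V1).toRows₁ := by
  rw [joinCols, stack, transpose_submatrix, transpose_fromRows]
  rfl

theorem Qr_transpose_mul {μ ν κ κ' : Type*} [Fintype μ] [Fintype ν] [Fintype κ] [DecidableEq μ]
    (P : Matrix μ κ ℝ) (Z : Matrix κ ν ℝ) (M : Matrix (ν ⊕ μ) κ' ℝ) :
    (Qr P Z)ᵀ * M = M.toRows₂ - P * Z * M.toRows₁ := by
  conv_lhs => rw [← fromRows_toRows M]
  rw [Qr, transpose_fromRows, fromCols_mul_fromRows, transpose_neg, transpose_transpose,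
    transpose_one, Matrix.one_mul, Matrix.neg_mul]
  abel

theorem permMatrix_mulVec_vec (M : Matrix (Fin d) (Fin n) ℝ) :
    permMatrix d n *ᵥ M.vec = Mᵀ.vec := by
  simp only [permMatrix, Matrix.sum_mulVec, kronecker_mulVec_vec]
  funext ⟨i, j⟩
  simp only [Finset.sum_apply, vec, transpose_single, single_mul_mul_single]
  simp [single_apply, ite_and]

/-! ### The derivative as the product `H G Z`. -/

section Factorization

variable {μ : Type*} [Fintype μ] [DecidableEq μ]

/-- The matrix whose transpose maps `[X; Z]` to `[U_sᵀ X; U₁ᵀ Z]`. -/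
def leftBasis (Us : Matrix (Fin a) (Fin a) ℝ) (U1 : Matrix μ (Fin b) ℝ) :
    Matrix (Fin a ⊕ μ) (Fin n) ℝ :=
  joinCols hn (fromRows Us 0) (fromRows 0 U1)

omit [DecidableEq μ] in
theorem leftBasis_transpose_mul {κ : Type*} (Us : Matrix (Fin a) (Fin a) ℝ)
    (U1 : Matrix μ (Fin b) ℝ) (M : Matrix (Fin a ⊕ μ) κ ℝ) :
    (leftBasis hn Us U1)ᵀ * M = stack hn (Usᵀ * M.toRows₁) (U1ᵀ * M.toRows₂) := by
  conv_lhs => rw [← fromRows_toRows M]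
  rw [leftBasis, joinCols_transpose_mul, transpose_fromRows, transpose_fromRows,
    fromCols_mul_fromRows, fromCols_mul_fromRows]
  simp

omit [DecidableEq μ] in
theorem leftBasis_orthonormal {Us : Matrix (Fin a) (Fin a) ℝ} {U1 : Matrix μ (Fin b) ℝ}
    (h1 : Usᵀ * Us = 1) (h2 : U1ᵀ * U1 = 1) :
    (leftBasis hn Us U1)ᵀ * leftBasis hn Us U1 = 1 := by
  refine joinCols_orthonormal hn ?_ ?_ ?_ <;>
    rw [transpose_fromRows, fromCols_mul_fromRows] <;> simp [h1, h2]

variable {D : Matrix (Fin a ⊕ μ) (Fin n ⊕ Fin d) ℝ} {Us : Matrix (Fin a) (Fin a) ℝ}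
    {s : Fin a → ℝ} {Vs : Matrix (Fin n ⊕ Fin d) (Fin a) ℝ}
    {V1 : Matrix (Fin n ⊕ Fin d) (Fin b) ℝ} {V2 : Matrix (Fin n ⊕ Fin d) (Fin d) ℝ}
    {U1 : Matrix μ (Fin b) ℝ} {U2 : Matrix μ (Fin d) ℝ}
    {σ1 : Fin b → ℝ} {σ2 : Fin d → ℝ} {Y : Matrix (Fin d) (Fin d) ℝ}

/-- The matrix inverted in `G` is invertible. -/
theorem isUnit_sylvester (hs : ∀ i, s i ≠ 0) (hgap : ∀ i j, σ2 j ^ 2 < σ1 i ^ 2) :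
    IsUnit ((block hn (diagonal s) 0 0 (diagonal σ1) ^ 2) ⊗ₖ (1 : Matrix (Fin d) (Fin d) ℝ) -
      (block hn 0 0 0 1) ⊗ₖ ((diagonal σ2)ᵀ * diagonal σ2)).det := by
  have h0 : (block hn 0 0 0 1 : Matrix (Fin n) (Fin n) ℝ) =
      diagonal (Sum.elim 0 1 ∘ (blockEquiv hn).symm) := by
    rw [← block_diagonal]
    simp
  rw [h0, block_diagonal, diagonal_pow, ← diagonal_one, diagonal_kronecker_diagonal,
    diagonal_transpose, diagonal_mul_diagonal, diagonal_kronecker_diagonal, diagonal_sub,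
    det_diagonal, isUnit_iff_ne_zero, Finset.prod_ne_zero_iff]
  rintro ⟨i, j⟩ -
  obtain ⟨i | i, rfl⟩ := (blockEquiv hn).surjective i
  · simpa using hs i
  · have := hgap i j
    simp
    nlinarith

/-- After vectorization the matrix inverted in `G` handles both equations at once: its first block
is division by `s²`, which with the factor `S` of `G` leaves `s⁻¹`, and its second is the Sylvester
map. The sign and the transpose are absorbed by `H`. -/
theorem AdaptedBasis.Gr_mulVec (h : AdaptedBasis D Us s Vs V1 V2 U1 U2 σ1 σ2 Y)
    {Z : Matrix (Fin n ⊕ Fin d) (Fin a) ℝ} {Δ : Matrix (Fin a ⊕ μ) (Fin n ⊕ Fin d) ℝ}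
    {x : Matrix (Fin a) (Fin d) ℝ} {y : Matrix (Fin b) (Fin d) ℝ}
    (hx : x = -(diagonal s⁻¹ * Usᵀ * (Δ.toRows₁ * V2)))
    (hy : diagonal σ1 * diagonal σ1 * y - y * diagonal σ2 * diagonal σ2 =
      -(diagonal σ1 * U1ᵀ * ((Δ.toRows₂ - D.toRows₂ * Z * Δ.toRows₁) * V2) +
        ((Δ.toRows₂ - D.toRows₂ * Z * Δ.toRows₁) * V1)ᵀ * U2 * diagonal σ2)) :
    Gr hn (block hn (diagonal s) 0 0 (diagonal σ1)) (diagonal σ2) *ᵥ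
      (Zr hn D.toRows₂ Z Us U1 U2 *ᵥ
        coords (joinCols hn Vs V1) V2 (leftBasis hn Us U1) Δ) = (-(stack hn x y)ᵀ).vec := by
  set T := (block hn (diagonal s) 0 0 (diagonal σ1) ^ 2) ⊗ₖ (1 : Matrix (Fin d) (Fin d) ℝ) -
      (block hn 0 0 0 1) ⊗ₖ ((diagonal σ2)ᵀ * diagonal σ2) with hT
  have hTu : IsUnit T.det := isUnit_sylvester hn h.s_ne h.sq_gap
  have hss : diagonal s * diagonal s⁻¹ = (1 : Matrix (Fin a) (Fin a) ℝ) := by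
    rw [diagonal_mul_diagonal, ← diagonal_one]
    congr 1
    funext i
    exact mul_inv_cancel₀ (h.s_ne i)
  have key : fromCols ((1 : Matrix (Fin n) (Fin n) ℝ) ⊗ₖ (diagonal σ2)ᵀ)
      (block hn (diagonal s) 0 0 (diagonal σ1) ⊗ₖ (1 : Matrix (Fin d) (Fin d) ℝ)) *ᵥ
      (Zr hn D.toRows₂ Z Us U1 U2 *ᵥ
        coords (joinCols hn Vs V1) V2 (leftBasis hn Us U1) Δ) =
      T *ᵥ (-(stack hn x y)ᵀ).vec := by
    rw [Zr, coords, fromBlocks_mulVec, Sum.elim_comp_inl, Sum.elim_comp_inr, zero_mulVec,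
      zero_mulVec, add_zero, zero_add, kronecker_mulVec_vec, kronecker_mulVec_vec,
      fromCols_mulVec_sumElim, kronecker_mulVec_vec, kronecker_mulVec_vec, hT, sub_mulVec,
      kronecker_mulVec_vec, kronecker_mulVec_vec, ← vec_add, ← vec_sub]
    congr 1
    -- After transposition all matrices are stacked in rows, so the two blocks separate.
    apply transpose_injective
    simp only [transpose_add, transpose_sub, transpose_mul, transpose_neg, transpose_transpose,
      transpose_one, Matrix.one_mul, Matrix.mul_one, diagonal_transpose, Matrix.mul_neg,
      Matrix.neg_mul]
    have e1 : (joinCols hn Vs V1)ᵀ * Δᵀ * (Qr D.toRows₂ Z * U2) =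
        stack hn ((Δ * Vs)ᵀ * Qr D.toRows₂ Z * U2) ((Δ * V1)ᵀ * Qr D.toRows₂ Z * U2) := by
      rw [joinCols_transpose_mul, stack_mul]
      simp only [transpose_mul, Matrix.mul_assoc]
    have e2 : ((Δ * V1)ᵀ * Qr D.toRows₂ Z) =
        ((Δ.toRows₂ - D.toRows₂ * Z * Δ.toRows₁) * V1)ᵀ := by
      rw [← Qr_transpose_mul, transpose_mul, transpose_mul, transpose_mul, transpose_transpose,
        Matrix.mul_assoc]
    have e3 : (Δ * V2).toRows₁ = Δ.toRows₁ * V2 := rfl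
    have e4 : (Δ * V2).toRows₂ = Δ.toRows₂ * V2 := rfl
    have hUs : Us * Usᵀ = 1 := mul_eq_one_comm.1 h.Us_Us
    rw [e1, leftBasis_transpose_mul, sq, Matrix.mul_assoc (block hn _ _ _ _) (block hn _ _ _ _),
      sub_neg_eq_add]
    simp only [block_mul_stack, stack_mul, stack_neg, stack_add, Matrix.zero_mul,
      Matrix.one_mul, add_zero, zero_add, e3, e4]
    congr 1
    · rw [hx, Matrix.mul_neg, Matrix.mul_neg, neg_neg, Matrix.mul_assoc (diagonal s⁻¹),
        ← Matrix.mul_assoc (diagonal s) (diagonal s⁻¹), hss, Matrix.one_mul]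
    -- The lower left block of `Z` recombines the coordinates `Usᵀ ΔS V2` and `U1ᵀ ΔP V2` into `U1ᵀ
    -- (ΔP - P Z ΔS) V2`, since `Us` is orthogonal.
    · have e5 : -(U1ᵀ * (D.toRows₂ * Z) * Us) * (Usᵀ * (Δ.toRows₁ * V2)) +
          U1ᵀ * (Δ.toRows₂ * V2) = U1ᵀ * ((Δ.toRows₂ - D.toRows₂ * Z * Δ.toRows₁) * V2) := by
        have : U1ᵀ * (D.toRows₂ * Z) * Us * (Usᵀ * (Δ.toRows₁ * V2)) =
            U1ᵀ * (D.toRows₂ * Z * Δ.toRows₁ * V2) := by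
          calc _ = U1ᵀ * (D.toRows₂ * Z) * (Us * Usᵀ) * (Δ.toRows₁ * V2) := by
                simp only [Matrix.mul_assoc]
            _ = _ := by rw [hUs, Matrix.mul_one]; simp only [Matrix.mul_assoc]
        rw [Matrix.neg_mul, this, Matrix.sub_mul, Matrix.mul_sub]
        abel
      rw [e5, e2]
      have e6 : -(diagonal σ1 * (diagonal σ1 * y)) + y * (diagonal σ2 * diagonal σ2) =
          -(diagonal σ1 * diagonal σ1 * y - y * diagonal σ2 * diagonal σ2) := by
        simp only [Matrix.mul_assoc]; abel
      rw [e6, hy, neg_neg, ← Matrix.mul_assoc (diagonal σ1)]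
      abel
  rw [Gr, ← mulVec_mulVec, key, mulVec_mulVec, nonsing_inv_mul _ hTu, one_mulVec]

omit [DecidableEq μ] in
-- The matrix `[I, X]` annihilates `V2`, while `W Wᵀ = 1 - V2 V2ᵀ` for `W = [V_s, V₁]`. Hence `[I,
-- X] W Wᵀ = [I, X]`, and its first block column reads `([I, X] W) W₁ᵀ = I`. In particular `W₁` is
-- invertible.
theorem AdaptedBasis.fromCols_mul_eq (h : AdaptedBasis D Us s Vs V1 V2 U1 U2 σ1 σ2 Y) :
    fromCols (1 : Matrix (Fin n) (Fin n) ℝ) (baseSol V2 Y) * joinCols hn Vs V1 =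
      ((W1 hn Vs V1)⁻¹)ᵀ := by
  have hY : Y * -V2.toRows₂ = 1 :=
    mul_eq_one_comm.1 (by rw [Matrix.neg_mul, h.V22_Y, neg_neg])
  have h1 : joinCols hn Vs V1 * (joinCols hn Vs V1)ᵀ = 1 - V2 * V2ᵀ := by
    rw [joinCols_mul_transpose, ← h.complete, add_sub_cancel_right]
  have h2 : fromCols (1 : Matrix (Fin n) (Fin n) ℝ) (baseSol V2 Y) * V2 = 0 := by
    have : baseSol V2 Y = V2.toRows₁ * Y := rfl
    conv_lhs => rw [← fromRows_toRows V2]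
    rw [fromCols_mul_fromRows, fromRows_toRows, this, Matrix.one_mul, Matrix.mul_assoc,
      ← neg_neg (Y * V2.toRows₂), ← Matrix.mul_neg, hY, Matrix.mul_neg, Matrix.mul_one,
      add_neg_cancel]
  have h3 : fromCols (1 : Matrix (Fin n) (Fin n) ℝ) (baseSol V2 Y) * joinCols hn Vs V1 *
      (joinCols hn Vs V1)ᵀ = fromCols 1 (baseSol V2 Y) := by
    rw [Matrix.mul_assoc, h1, Matrix.mul_sub, Matrix.mul_one, ← Matrix.mul_assoc, h2,
      Matrix.zero_mul, sub_zero]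
  rw [transpose_nonsing_inv]
  refine (inv_eq_left_inv ?_).symm
  rw [W1_eq_toRows₁]
  have h4 := congrArg toCols₁ h3
  rw [toCols₁_fromCols] at h4
  exact h4

theorem AdaptedBasis.condition_matrix_mulVec (h : AdaptedBasis D Us s Vs V1 V2 U1 U2 σ1 σ2 Y)
    {Z : Matrix (Fin n ⊕ Fin d) (Fin a) ℝ} {Δ : Matrix (Fin a ⊕ μ) (Fin n ⊕ Fin d) ℝ}
    {x : Matrix (Fin a) (Fin d) ℝ} {y : Matrix (Fin b) (Fin d) ℝ}
    (hx : x = -(diagonal s⁻¹ * Usᵀ * (Δ.toRows₁ * V2)))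
    (hy : diagonal σ1 * diagonal σ1 * y - y * diagonal σ2 * diagonal σ2 =
      -(diagonal σ1 * U1ᵀ * ((Δ.toRows₂ - D.toRows₂ * Z * Δ.toRows₁) * V2) +
        ((Δ.toRows₂ - D.toRows₂ * Z * Δ.toRows₁) * V1)ᵀ * U2 * diagonal σ2)) :
    (Hr V2.toRows₂ (W1 hn Vs V1) * Gr hn (block hn (diagonal s) 0 0 (diagonal σ1)) (diagonal σ2) *
      Zr hn D.toRows₂ Z Us U1 U2) *ᵥ coords (joinCols hn Vs V1) V2 (leftBasis hn Us U1) Δ =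
      (fromCols (1 : Matrix (Fin n) (Fin n) ℝ) (baseSol V2 Y) * (Vs * x + V1 * y) * Y).vec := by
  have hY : V2.toRows₂⁻¹ = -Y :=
    inv_eq_right_inv (by rw [Matrix.mul_neg, h.V22_Y, neg_neg])
  rw [← mulVec_mulVec, ← mulVec_mulVec, h.Gr_mulVec hn hx hy, Hr, ← mulVec_mulVec,
    permMatrix_mulVec_vec, kronecker_mulVec_vec, ← joinCols_mul_stack hn, ← Matrix.mul_assoc,
    h.fromCols_mul_eq hn, transpose_transpose, transpose_neg, transpose_transpose, hY]
  simp only [Matrix.mul_neg, Matrix.neg_mul, neg_neg]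

end Factorization

end Blocks

end RBTLSE

namespace RBTLSE

/-! ### Local solvability and the condition number of the real problem. -/

section Norm

open scoped Matrix.Norms.Frobenius

variable {a b n d : ℕ} (hn : n = a + b) {μ : Type*} [Fintype μ] [DecidableEq μ]
  {D : Matrix (Fin a ⊕ μ) (Fin n ⊕ Fin d) ℝ} {Us : Matrix (Fin a) (Fin a) ℝ}
  {s : Fin a → ℝ} {Vs : Matrix (Fin n ⊕ Fin d) (Fin a) ℝ}
  {V1 : Matrix (Fin n ⊕ Fin d) (Fin b) ℝ} {V2 : Matrix (Fin n ⊕ Fin d) (Fin d) ℝ}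
  {U1 : Matrix μ (Fin b) ℝ} {U2 : Matrix μ (Fin d) ℝ}
  {σ1 : Fin b → ℝ} {σ2 : Fin d → ℝ} {Y : Matrix (Fin d) (Fin d) ℝ}

omit [DecidableEq μ] in
theorem AdaptedBasis.isTLSESol_iff (h : AdaptedBasis D Us s Vs V1 V2 U1 U2 σ1 σ2 Y)
    (X : Matrix (Fin n) (Fin d) ℝ) : IsTLSESol D X ↔ X = baseSol V2 Y := by
  obtain ⟨φ, L, -, hφD, hsol, -⟩ := h.exists_solution_map
  rw [hsol.self_of_nhds X, hφD]

/-- Existence and uniqueness of the solution near the data, and its condition number. -/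
theorem AdaptedBasis.condition_number (h : AdaptedBasis D Us s Vs V1 V2 U1 U2 σ1 σ2 Y)
    (hX0 : baseSol V2 Y ≠ 0) :
    (∃ δ > 0, ∀ Δ, frob Δ ≤ δ * frob D → ∃! X, IsTLSESol (D + Δ) X) ∧
    ∃ t : ℝ → ℝ, (∀ᶠ ε in 𝓝[>] (0 : ℝ), IsLUB {r | ∃ Δ X, frob Δ ≤ ε * frob D ∧
      IsTLSESol (D + Δ) X ∧ r = frob (baseSol V2 Y - X) / (ε * frob (baseSol V2 Y))} (t ε)) ∧
      Tendsto t (𝓝[>] (0 : ℝ)) (𝓝 (specNorm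
        (Hr V2.toRows₂ (W1 hn Vs V1) * Gr hn (block hn (diagonal s) 0 0 (diagonal σ1))
          (diagonal σ2) * Zr hn D.toRows₂ (Vs * diagonal s⁻¹ * Usᵀ) Us U1 U2) *
        frob D / frob (baseSol V2 Y))) := by
  obtain ⟨φ, L, hφ, hφD, hsol, hL⟩ := h.exists_solution_map
  have hD : D ≠ 0 := by
    rintro rfl
    have hU := congrArg (fun M => U2ᵀ * M) h.P_V2
    have h0 : (0 : Matrix (Fin a ⊕ μ) (Fin n ⊕ Fin d) ℝ).toRows₂ = 0 := rfl
    simp only [h0, Matrix.zero_mul, Matrix.mul_zero, ← Matrix.mul_assoc, h.U2_U2,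
      Matrix.one_mul] at hU
    -- If `d = 0` there is no singular value to contradict; the column index `j` of an entry of `X`
    -- provides one.
    refine hX0 ?_
    ext i j
    have := congrFun (congrFun hU j) j
    rw [diagonal_apply_eq] at this
    exact absurd this (h.pos j).ne
  have hD' : 0 < frob D := norm_pos_iff.2 hD
  have hX' : 0 < frob (baseSol V2 Y) := norm_pos_iff.2 hX0
  obtain ⟨δ, hδ, hball⟩ := Metric.eventually_nhds_iff.1 hsol
  have hloc : ∀ Δ : Matrix (Fin a ⊕ μ) (Fin n ⊕ Fin d) ℝ, frob Δ < δ →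
      ∀ X, IsTLSESol (D + Δ) X ↔ X = φ (D + Δ) := fun Δ hΔ X => by
    refine hball ?_ X
    rw [dist_eq_norm, add_sub_cancel_left]
    exact hΔ
  -- The factor 2 places the closed ball of perturbations inside the open ball of radius `δ`.
  refine ⟨⟨δ / (2 * frob D), by positivity,
    fun Δ hΔ => ?_⟩, ?_⟩
  · have : frob Δ < δ := by
      have h1 : δ / (2 * frob D) * frob D = δ / 2 := by field_simp
      linarith
    exact ⟨_, (hloc Δ this _).2 rfl, fun X hX => (hloc Δ this X).1 hX⟩
  · obtain ⟨t, ht1, ht2⟩ := exists_tendsto_sup_errors hφ hD' hX'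
    refine ⟨t, ?_, ?_⟩
    · have h3 : ∀ᶠ ε in 𝓝[>] (0 : ℝ), ε * frob D < δ := by
        have : Tendsto (fun ε : ℝ => ε * frob D) (𝓝 0) (𝓝 (0 * frob D)) :=
          tendsto_id.mul_const _
        rw [zero_mul] at this
        exact (this.mono_left nhdsWithin_le_nhds).eventually (gt_mem_nhds hδ)
      filter_upwards [ht1, h3] with ε h1 h2
      convert! h1 using 1
      ext r
      constructor
      · rintro ⟨Δ, X, hΔ, hX, rfl⟩
        rw [hloc Δ (lt_of_le_of_lt hΔ h2)] at hX
        refine ⟨Δ, hΔ, ?_⟩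
        rw [hX, hφD]
        rfl
      · rintro ⟨Δ, hΔ, rfl⟩
        refine ⟨Δ, _, hΔ, (hloc Δ (lt_of_le_of_lt hΔ h2) _).2 rfl, ?_⟩
        rw [hφD]
        rfl
    · rw [← opNorm_eq_specNorm L _ (coords (joinCols hn Vs V1) V2 (leftBasis hn Us U1))
        ?_ (norm_coords_le ?_ (leftBasis_orthonormal hn h.Us_Us h.U1_U1))
        (exists_coords_eq ?_ (leftBasis_orthonormal hn h.Us_Us h.U1_U1)
          (joinCols_orthonormal hn h.Vs_Vs h.Vs_V1 h.V1_V1) ?_ h.V2_V2)]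
      · exact ht2
      · intro Δ
        obtain ⟨x, y, hL, hx, hy⟩ := hL Δ
        rw [h.condition_matrix_mulVec hn hx hy, ← hL, norm_toLp_vec]
        rfl
      · rw [joinCols_mul_transpose, h.complete]
      · rw [joinCols_mul_transpose, h.complete]
      · rw [joinCols_transpose_mul, h.Vs_V2, h.V1_V2]
        ext i j
        obtain ⟨i | i, rfl⟩ := (blockEquiv hn).surjective i <;> simp [stack]

end Norm

/-! ### From the QR and singular value factorizations to an adapted basis. -/

section Assembly

theorem toRows_orthonormal_blocks {κ α γ : Type*} [Fintype κ] [DecidableEq α]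
    [DecidableEq γ] {Q1 : Matrix κ α ℝ} {Q2 : Matrix κ γ ℝ}
    (hQ : (fromCols Q1 Q2)ᵀ * fromCols Q1 Q2 = 1) :
    Q1ᵀ * Q1 = 1 ∧ Q1ᵀ * Q2 = 0 ∧ Q2ᵀ * Q2 = 1 := by
  rw [transpose_fromCols, fromRows_mul_fromCols, ← fromBlocks_one, fromBlocks_inj] at hQ
  exact ⟨hQ.1, hQ.2.1, hQ.2.2.2⟩

theorem vecMul_eq_zero_of_rank {k n : ℕ} {M : Matrix (Fin k) (Fin n) ℝ} (hM : M.rank = k)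
    {v : Fin k → ℝ} (hv : v ᵥ* M = 0) : v = 0 := by
  have h : LinearIndependent ℝ M.row := by
    rw [linearIndependent_iff_card_eq_finrank_span, Set.finrank, ← rank_eq_finrank_span_row, hM,
      Fintype.card_fin]
  have := vecMul_injective_iff.2 h
  exact this (hv.trans (zero_vecMul M).symm)

section Columns

variable {κ : Type*} {a b : ℕ}

theorem gram_leftCols [Fintype κ] {M : Matrix κ (Fin (a + b)) ℝ} (hM : Mᵀ * M = 1) :
    (leftCols M)ᵀ * leftCols M = 1 ∧ (leftCols M)ᵀ * rightCols M = 0 ∧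
      (rightCols M)ᵀ * rightCols M = 1 := by
  refine ⟨?_, ?_, ?_⟩
  · change (Mᵀ * M).submatrix (Fin.castAdd b) (Fin.castAdd b) =
      (1 : Matrix (Fin a) (Fin a) ℝ)
    rw [hM]
    exact submatrix_one _ (Fin.castAdd_injective a b)
  · change (Mᵀ * M).submatrix (Fin.castAdd b) (Fin.natAdd a) = 0
    rw [hM]
    ext i j
    refine one_apply_ne fun h => ?_
    have := congrArg Fin.val h
    simp at this
    omega
  · change (Mᵀ * M).submatrix (Fin.natAdd a) (Fin.natAdd a) =
      (1 : Matrix (Fin b) (Fin b) ℝ)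
    rw [hM]
    exact submatrix_one _ (Fin.natAdd_injective b a)

theorem leftCols_add_rightCols (M : Matrix κ (Fin (a + b)) ℝ) :
    leftCols M * (leftCols M)ᵀ + rightCols M * (rightCols M)ᵀ = M * Mᵀ := by
  ext i j
  simp only [Matrix.add_apply, mul_apply, transpose_apply, Fin.sum_univ_add]
  rfl

theorem leftCols_mul_diagonal (M : Matrix κ (Fin (a + b)) ℝ) (σ : Fin (a + b) → ℝ) :
    leftCols (M * diagonal σ) = leftCols M * diagonal fun i => σ (Fin.castAdd b i) := by
  ext i j
  simp [leftCols, mul_diagonal]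

theorem rightCols_mul_diagonal (M : Matrix κ (Fin (a + b)) ℝ) (σ : Fin (a + b) → ℝ) :
    rightCols (M * diagonal σ) = rightCols M * diagonal fun i => σ (Fin.natAdd a i) := by
  ext i j
  simp [rightCols, mul_diagonal]

end Columns

theorem diagonal_mul_diagonal_inv {ν : Type*} [Fintype ν] [DecidableEq ν] {s : ν → ℝ}
    (hs : ∀ i, s i ≠ 0) :
    diagonal s * diagonal s⁻¹ = 1 := by
  rw [diagonal_mul_diagonal, ← diagonal_one]
  congr 1
  funext i
  exact mul_inv_cancel₀ (hs i)

/-- The singular values of a matrix of full row rank do not vanish. -/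
theorem IsThinSVD.ne_zero {κ : Type*} [Fintype κ] {k : ℕ} {S : Matrix (Fin k) κ ℝ}
    {Us : Matrix (Fin k) (Fin k) ℝ} {s : Fin k → ℝ} {Vs : Matrix κ (Fin k) ℝ}
    (h : IsThinSVD S Us s Vs) (hS : ∀ v, v ᵥ* S = 0 → v = 0) (i : Fin k) : s i ≠ 0 := by
  intro hi
  have h1 : Usᵀ * S = diagonal s * Vsᵀ := by
    rw [h.eq, ← Matrix.mul_assoc, ← Matrix.mul_assoc, h.left_orthonormal, Matrix.one_mul]
  have h2 : Usᵀ.row i ᵥ* S = 0 := by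
    funext j
    have := congrFun (congrFun h1 i) j
    rw [diagonal_mul, hi, zero_mul] at this
    exact this
  have h3 := congrFun (congrFun h.left_orthonormal i) i
  have h4 : (Usᵀ * Us) i i = Usᵀ.row i ⬝ᵥ Us.col i := rfl
  rw [h4, hS _ h2, zero_dotProduct, one_apply_eq] at h3
  exact zero_ne_one h3

/-- Nonvanishing singular values give `S` a right inverse, hence `S S† = 1`; symmetry of `S† S` puts
the columns of `S†` in the span of `Vs`. This identifies the `S†` of `Q` and `Z` with the inverse
produced by the linearization. -/
theorem IsMoorePenrose.eq_of_svd {κ : Type*} [Fintype κ] {k : ℕ} {S : Matrix (Fin k) κ ℝ}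
    {Us : Matrix (Fin k) (Fin k) ℝ} {s : Fin k → ℝ} {Vs : Matrix κ (Fin k) ℝ}
    {Sdag : Matrix κ (Fin k) ℝ} (hd : IsMoorePenrose S Sdag) (h : IsThinSVD S Us s Vs)
    (hs : ∀ i, s i ≠ 0) : Sdag = Vs * diagonal s⁻¹ * Usᵀ := by
  have hss := diagonal_mul_diagonal_inv hs
  have hU := mul_eq_one_comm.1 h.left_orthonormal
  have h1 : S * (Vs * diagonal s⁻¹ * Usᵀ) = 1 := by
    calc _ = Us * diagonal s * (Vsᵀ * Vs) * diagonal s⁻¹ * Usᵀ := by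
          rw [h.eq]; simp only [Matrix.mul_assoc]
      _ = Us * (diagonal s * diagonal s⁻¹) * Usᵀ := by
          rw [h.right_orthonormal, Matrix.mul_one, Matrix.mul_assoc Us]
      _ = 1 := by rw [hss, Matrix.mul_one, hU]
  have h2 : S * Sdag = 1 := by
    rw [← h1]
    conv_rhs => rw [← hd.mul_mul]
    rw [Matrix.mul_assoc _ S, h1, Matrix.mul_one]
  have h3 : Sdag = Vs * (diagonal s * Usᵀ * Sdagᵀ * Sdag) := by
    conv_lhs => rw [← hd.inv_mul_inv, ← hd.right_symm, transpose_mul, h.eq]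
    simp only [transpose_mul, transpose_transpose, diagonal_transpose, Matrix.mul_assoc]
  have h4 : Vs * (Vsᵀ * Sdag) = Sdag := by
    rw [h3, ← Matrix.mul_assoc Vsᵀ, h.right_orthonormal, Matrix.one_mul]
  have h5 : Vsᵀ * Sdag = diagonal s⁻¹ * Usᵀ := by
    have h6 : diagonal s * (Vsᵀ * Sdag) = Usᵀ := by
      calc _ = Usᵀ * Us * (diagonal s * (Vsᵀ * Sdag)) := by
            rw [h.left_orthonormal, Matrix.one_mul]
        _ = Usᵀ * (S * Sdag) := by rw [h.eq]; simp only [Matrix.mul_assoc]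
        _ = Usᵀ := by rw [h2, Matrix.mul_one]
    rw [← h6, ← Matrix.mul_assoc, mul_eq_one_comm.1 hss, Matrix.one_mul]
  rw [← h4, h5, Matrix.mul_assoc]

theorem exists_adaptedBasis {k m n d q : ℕ} {D : Matrix (Fin k ⊕ Fin m) (Fin n ⊕ Fin d) ℝ}
    {Q1 : Matrix (Fin n ⊕ Fin d) (Fin k) ℝ} {Q2 : Matrix (Fin n ⊕ Fin d) (Fin (q + d)) ℝ}
    {R : Matrix (Fin k) (Fin k) ℝ}
    (hQ : (fromCols Q1 Q2)ᵀ * fromCols Q1 Q2 = 1)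
    (hQ' : fromCols Q1 Q2 * (fromCols Q1 Q2)ᵀ = 1)
    (hQR : D.toRows₁ᵀ = fromCols Q1 Q2 * fromRows R (0 : Matrix (Fin (q + d)) (Fin k) ℝ))
    {U : Matrix (Fin m) (Fin (q + d)) ℝ} {σ : Fin (q + d) → ℝ}
    {V : Matrix (Fin (q + d)) (Fin (q + d)) ℝ}
    (hsvd : IsThinSVD (D.toRows₂ * Q2) U σ V) (hσ : ∀ i, 0 < σ i)
    (hgap : ∀ (i : Fin q) (j : Fin d), σ (Fin.natAdd q j) < σ (Fin.castAdd d i))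
    (hV22 : IsUnit (rightCols (Q2 * V)).toRows₂)
    {Us : Matrix (Fin k) (Fin k) ℝ} {s : Fin k → ℝ} {Vs : Matrix (Fin n ⊕ Fin d) (Fin k) ℝ}
    (hsvdS : IsThinSVD D.toRows₁ Us s Vs) (hs : ∀ i, s i ≠ 0) :
    AdaptedBasis D Us s Vs (leftCols (Q2 * V)) (rightCols (Q2 * V)) (leftCols U) (rightCols U)
      (fun i => σ (Fin.castAdd d i)) (fun j => σ (Fin.natAdd q j))
      (-(rightCols (Q2 * V)).toRows₂⁻¹) := by
  obtain ⟨q11, q12, q22⟩ := toRows_orthonormal_blocks hQ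
  have hss := diagonal_mul_diagonal_inv hs
  have hVV := mul_eq_one_comm.1 hsvd.right_orthonormal
  have hM : (Q2 * V)ᵀ * (Q2 * V) = 1 := by
    rw [transpose_mul, Matrix.mul_assoc, ← Matrix.mul_assoc Q2ᵀ, q22, Matrix.one_mul,
      hsvd.right_orthonormal]
  obtain ⟨m11, m12, m22⟩ := gram_leftCols hM
  obtain ⟨u11, u12, u22⟩ := gram_leftCols hsvd.left_orthonormal
  have hPM : D.toRows₂ * (Q2 * V) = U * diagonal σ := by
    rw [← Matrix.mul_assoc, hsvd.eq, Matrix.mul_assoc, hsvd.right_orthonormal, Matrix.mul_one]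
  -- The columns of `Vs` lie in the range of `Sᵀ`, hence in the span of `Q1`. The square factor `O`
  -- is orthogonal, so `Vs Vsᵀ = Q1 Q1ᵀ`, which gives completeness of the basis.
  obtain ⟨O, hO⟩ : ∃ O : Matrix (Fin k) (Fin k) ℝ, Vs = Q1 * O := by
    refine ⟨R * Us * diagonal s⁻¹, ?_⟩
    have h1 : D.toRows₁ᵀ = Q1 * R := by
      rw [hQR, fromCols_mul_fromRows, Matrix.mul_zero, add_zero]
    calc Vs = Vs * diagonal s * (Usᵀ * Us) * diagonal s⁻¹ := by
          rw [hsvdS.left_orthonormal, Matrix.mul_one, Matrix.mul_assoc, hss, Matrix.mul_one]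
      _ = D.toRows₁ᵀ * Us * diagonal s⁻¹ := by
          rw [hsvdS.eq]
          simp only [transpose_mul, transpose_transpose, diagonal_transpose, Matrix.mul_assoc]
      _ = _ := by rw [h1]; simp only [Matrix.mul_assoc]
  have hOO : O * Oᵀ = 1 := by
    refine mul_eq_one_comm.1 ?_
    rw [← hsvdS.right_orthonormal, hO, transpose_mul, Matrix.mul_assoc, ← Matrix.mul_assoc Q1ᵀ,
      q11, Matrix.one_mul]
  have hVsM : Vsᵀ * (Q2 * V) = 0 := by
    rw [hO, transpose_mul, Matrix.mul_assoc, ← Matrix.mul_assoc Q1ᵀ, q12, Matrix.zero_mul,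
      Matrix.mul_zero]
  exact
    { Vs_Vs := hsvdS.right_orthonormal
      Vs_V1 := congrArg leftCols hVsM
      Vs_V2 := congrArg rightCols hVsM
      V1_V1 := m11
      V1_V2 := m12
      V2_V2 := m22
      complete := by
        rw [add_assoc, leftCols_add_rightCols, transpose_mul, Matrix.mul_assoc,
          ← Matrix.mul_assoc V, hVV, Matrix.one_mul, hO, transpose_mul, Matrix.mul_assoc,
          ← Matrix.mul_assoc O, hOO, Matrix.one_mul, ← fromCols_mul_fromRows, ← transpose_fromCols,
          hQ']
      Us_Us := hsvdS.left_orthonormal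
      s_ne := hs
      S_eq := hsvdS.eq
      U1_U1 := u11
      U1_U2 := u12
      U2_U2 := u22
      P_V1 := (congrArg leftCols hPM).trans (leftCols_mul_diagonal U σ)
      P_V2 := (congrArg rightCols hPM).trans (rightCols_mul_diagonal U σ)
      gap := hgap
      pos := fun j => hσ _
      V22_Y := by
        rw [Matrix.mul_neg, mul_nonsing_inv _ ((isUnit_iff_isUnit_det _).1 hV22)] }

end Assembly

end RBTLSE

/-! ### The condition number of the reduced biquaternion problem. -/

theorem theorem5p1 {m n d p q : ℕ}
    (A : Matrix (Fin m) (Fin n) RBQ) (B : Matrix (Fin m) (Fin d) RBQ)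
    (C : Matrix (Fin p) (Fin n) RBQ) (D : Matrix (Fin p) (Fin d) RBQ)
    -- `q` is `n - 4p`; the rank condition on `C` already forces `4p ≤ n`
    (hq : n = 4 * p + q) (hm : n + d ≤ m)
    (hC : (RBTLSE.realCol C).rank = 4 * p)
    (P : Matrix (Fin (4 * m)) (Fin n ⊕ Fin d) ℝ)
    (hP : P = fromCols (RBTLSE.realCol A) (RBTLSE.realCol B))
    (S : Matrix (Fin (4 * p)) (Fin n ⊕ Fin d) ℝ)
    (hS : S = fromCols (RBTLSE.realCol C) (RBTLSE.realCol D))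
    -- QR factorization of `Sᵀ`
    (Q1 : Matrix (Fin n ⊕ Fin d) (Fin (4 * p)) ℝ)
    (Q2 : Matrix (Fin n ⊕ Fin d) (Fin (q + d)) ℝ)
    (R : Matrix (Fin (4 * p)) (Fin (4 * p)) ℝ)
    (hQ : (fromCols Q1 Q2)ᵀ * fromCols Q1 Q2 = 1)
    (hQ' : fromCols Q1 Q2 * (fromCols Q1 Q2)ᵀ = 1)
    (hR : R.BlockTriangular id)
    (hQR : Sᵀ = fromCols Q1 Q2 * fromRows R (0 : Matrix (Fin (q + d)) (Fin (4 * p)) ℝ))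
    -- thin SVD of `P Q2`
    (U : Matrix (Fin (4 * m)) (Fin (q + d)) ℝ) (σ : Fin (q + d) → ℝ)
    (V : Matrix (Fin (q + d)) (Fin (q + d)) ℝ)
    (hsvd : RBTLSE.IsThinSVD (P * Q2) U σ V)
    (hσ : ∀ i, 0 < σ i)
    (hgap : ∀ (i : Fin q) (j : Fin d), σ (Fin.natAdd q j) < σ (Fin.castAdd d i))
    (U1 : Matrix (Fin (4 * m)) (Fin q) ℝ) (hU1 : U1 = RBTLSE.leftCols U)
    (U2 : Matrix (Fin (4 * m)) (Fin d) ℝ) (hU2 : U2 = RBTLSE.rightCols U)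
    (Sig1 : Matrix (Fin q) (Fin q) ℝ) (hSig1 : Sig1 = diagonal fun i => σ (Fin.castAdd d i))
    (Sig2 : Matrix (Fin d) (Fin d) ℝ) (hSig2 : Sig2 = diagonal fun j => σ (Fin.natAdd q j))
    (V1 : Matrix (Fin n ⊕ Fin d) (Fin q) ℝ) (hV1 : V1 = RBTLSE.leftCols (Q2 * V))
    (V22 : Matrix (Fin d) (Fin d) ℝ)
    (hV22 : V22 = (RBTLSE.rightCols (Q2 * V)).submatrix Sum.inr id)
    (hV22_unit : IsUnit V22)
    -- skinny SVD of `S`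
    (Us : Matrix (Fin (4 * p)) (Fin (4 * p)) ℝ) (s : Fin (4 * p) → ℝ)
    (Vs : Matrix (Fin n ⊕ Fin d) (Fin (4 * p)) ℝ)
    (hsvdS : RBTLSE.IsThinSVD S Us s Vs)
    (Sdag : Matrix (Fin n ⊕ Fin d) (Fin (4 * p)) ℝ)
    (hSdag : RBTLSE.IsMoorePenrose S Sdag)
    (Sr : Matrix (Fin n) (Fin n) ℝ)
    (hSr : Sr = RBTLSE.block hq (diagonal s) 0 0 Sig1)
    (Jr : Matrix (Fin (4 * p) ⊕ Fin (4 * m)) (Fin n) ℝ)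
    (hJr : Jr = fromRows (RBTLSE.realCol C) (RBTLSE.realCol A))
    (Kr : Matrix (Fin (4 * p) ⊕ Fin (4 * m)) (Fin d) ℝ)
    (hKr : Kr = fromRows (RBTLSE.realCol D) (RBTLSE.realCol B))
    -- the real solution; its relative error makes sense only if it is nonzero
    (X : Matrix (Fin n) (Fin d) ℝ)
    (hX : RBTLSE.IsRealSolution A B C D X) (hX0 : X ≠ 0) :
    RBTLSE.LocallyUniquelySolvable A B C D ∧
    RBTLSE.HasRelCondNumber A B C D X
      (RBTLSE.specNorm
          (RBTLSE.Hr V22 (RBTLSE.W1 hq Vs V1) * RBTLSE.Gr hq Sr Sig2 *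
            RBTLSE.Zr hq P Sdag Us U1 U2) *
        RBTLSE.frob (fromCols Jr Kr) / RBTLSE.frob X) := by
  subst hU1 hU2 hSig1 hSig2 hV1 hV22 hSr hJr hKr
  set T := RBTLSE.realData A B C D with hT
  have hTS : T.toRows₁ = S := by rw [hS]; rfl
  have hTP : T.toRows₂ = P := by rw [hP]; rfl
  -- A left null vector of `[C, D]` is one of `C`, whose stacked rows are independent.
  have hs : ∀ i, s i ≠ 0 := by
    refine hsvdS.ne_zero fun v hv => RBTLSE.vecMul_eq_zero_of_rank hC ?_
    rw [hS, vecMul_fromCols] at hv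
    funext j
    exact congrFun hv (Sum.inl j)
  have hSd := hSdag.eq_of_svd hsvdS hs
  rw [← hTS] at hQR hsvdS
  rw [← hTP] at hsvd
  have h := RBTLSE.exists_adaptedBasis hQ hQ' hQR hsvd hσ hgap hV22_unit hsvdS hs
  rw [RBTLSE.isRealSolution_iff] at hX
  have hXB : X = RBTLSE.baseSol (RBTLSE.rightCols (Q2 * V))
      (-(RBTLSE.rightCols (Q2 * V)).toRows₂⁻¹) :=
    (h.isTLSESol_iff X).1 hX
  obtain ⟨⟨δ, hδ, hloc⟩, t, ht1, ht2⟩ := h.condition_number hq (hXB ▸ hX0)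
  refine ⟨⟨δ, hδ, fun ΔA ΔB ΔC ΔD hΔ => ?_⟩, t, ?_, ?_⟩
  · rw [RBTLSE.dataNorm_eq, RBTLSE.dataNorm_eq] at hΔ
    simp only [RBTLSE.isRealSolution_iff, RBTLSE.realData_add]
    exact hloc _ hΔ
  · filter_upwards [ht1] with ε hε
    convert! hε using 1
    ext r
    simp only [RBTLSE.relErrors, RBTLSE.isRealSolution_iff, RBTLSE.realData_add,
      RBTLSE.dataNorm_eq, ← hXB, Set.mem_ofPred_eq]
    constructor
    · rintro ⟨ΔA, ΔB, ΔC, ΔD, X', h1, h2, h3⟩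
      exact ⟨_, X', h1, h2, h3⟩
    · rintro ⟨Δ, X', h1, h2, h3⟩
      obtain ⟨ΔA, ΔB, ΔC, ΔD, rfl⟩ := RBTLSE.realData_surjective Δ
      exact ⟨ΔA, ΔB, ΔC, ΔD, X', h1, h2, h3⟩
  · have hJK : fromCols (fromRows (RBTLSE.realCol C) (RBTLSE.realCol A))
        (fromRows (RBTLSE.realCol D) (RBTLSE.realCol B)) = T := by
      ext (i | i) (j | j) <;> rfl
    rw [← hXB, hTP, ← hSd] at ht2
    rw [hJK]
    exact ht2
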